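/- Let $\mathbb K$ be a field and $n\ge 2$. Let $C=(c_{ij})$ be the generic skew symmetric $n\times n$ matrix (with zero diagonal), $U=(u_{kl})$ the generic $3\times n$ matrix with rows $u_1,u_2,u_3$, and $R$ the polynomial ring over $\mathbb K$ in the entries $c_{ij}$ $(i<j)$ and $u_{kl}$. For $A\subseteq\{1,\dots,n\}$ let $\mathrm{Pf}(A)$ be the Pfaffian of the submatrix of $C$ on the rows and columns in $A$ ($\mathrm{Pf}(\emptyset)=1$, and $\mathrm{Pf}(A)=0$ if $|A|$ is odd). For rows $a_1,\dots,a_r$ let $$[A\,|\,a_1,\dots,a_r]=\sum_{\{s_1<\dots<s_r\}\subseteq A}\pm\,\Delta^{s_1,\dots,s_r}_{a_1,\dots,a_r}\,\mathrm{Pf}(A\setminus\{s_1,\dots,s_r\}),$$ where $\Delta^{s_1,\dots,s_r}_{a_1,\dots,a_r}$ is the minor of $U$ on these rows and columns and the sign is that of the permutation moving $s_1,\dots,s_r$ to the front of $A$; this is the coefficient of $\bigwedge_{i\in A}f_i$ in $u_{a_1}\wedge\dots\wedge u_{a_r}\wedge C^{(k)}$, where $r+2k=|A|$ and $C^{(k)}$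 is the $k$-th divided power of the 2-form $C$. Write $[n]=\{1,\dots,n\}$ and $\hat\jmath=[n]\setminus\{j\}$. If $n$ is odd, let $J_n$ be generated by $[\,[n]\,|\,1,2,3]$, $[\,[n]\,|\,1]$, $[\,[n]\,|\,2]$, $[\,[n]\,|\,3]$, and let $w_j=(-1)^{j-1}\mathrm{Pf}(\hat\jmath)$, $v_{1,j}=(-1)^{j}[\hat\jmath\,|\,2,3]$, $v_{2,j}=(-1)^{j-1}[\hat\jmath\,|\,1,3]$, $v_{3,j}=(-1)^{j}[\hat\jmath\,|\,1,2]$; let $\varphi_n$ be the $4\times n$ matrix with rows $(w_j)_j,(v_{1,j})_j,(v_{2,j})_j,(v_{3,j})_j$ reduced modulo $J_n$. If $n$ is even, let $J_n$ be generated by $\mathrm{Pf}([n])$, $[\,[n]\,|\,1,2]$, $[\,[n]\,|\,1,3]$, $[\,[n]\,|\,2,3]$, and let $w_j=(-1)^{j-1}[\hat\jmath\,|\,1,2,3]$ and $v_{\{\alpha,\beta\},j}=(-1)^{j-1}[\hat\jmath\,|\,\gamma]$ for $\{\alpha,\beta,\gamma\}=\{1,2,3\}$; let $\varphi_n$ be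 the $4\times n$ matrix with rows $(w_j)_j,(v_{\{2,3\},j})_j,(-v_{\{1,3\},j})_j,(v_{\{1,2\},j})_j$ reduced modulo $J_n$. Let $S_n=R/J_n$, let $\omega_{S_n}=\mathrm{Ext}^3_R(S_n,R)$ be its canonical module, let $d_3=\begin{bmatrix}C\\U\end{bmatrix}$ be the last map of the Christensen–Veliche–Weyman free resolution of $S_n$, and let $H_n$ be the transpose of $\varphi_n$. Then $\omega_{S_n}$ has a free presentation $$S_n^{n+3}\xrightarrow{\;d_3^t\otimes S_n\;}S_n^n\xrightarrow{\;\pi\;}\omega_{S_n}\to 0,$$ and, when $\mathrm{Hom}_{S_n}(\omega_{S_n},S_n)$ is regarded as a submodule of $S_n^n$ through any such presentation ($f\mapsto (f(\pi(e_j)))_j$), one has $\mathrm{im}(H_n)\subseteq \mathrm{Hom}_{S_n}(\omega_{S_n},S_n)$. -/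

import Mathlib

universe u

namespace AlmostCI

/-! ### Pfaffians and coefficients of wedge products -/

section Pfaffians

variable {R : Type u} [CommRing R]

/-- The Pfaffian of the alternating matrix `(C a b)`, `a, b` running through the entries of the
list, by expansion along its first row; the empty Pfaffian is `1`. -/
def pfList {ι : Type*} (C : Matrix ι ι R) : List ι → R
  | [] => 1
  | i :: l => ∑ k : Fin l.length, (-1) ^ (k : ℕ) * C i (l.get k) * pfList C (l.eraseIdx k)
termination_by l => l.length
decreasing_by
  have h := List.length_eraseIdx_le l (k : ℕ)
  simp only [List.length_cons]
  omega

/-- `pf C A` is the Pfaffian of the submatrix of `C` on the rows and columns in `A`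
(it is `0` if `A` has an odd number of elements). It is the coefficient of the basis vector
`f_A` in the divided power `C^(k)`, `2 * k = #A`, of the 2-form attached to `C`. -/
def pf {n : ℕ} (C : Matrix (Fin n) (Fin n) R) (A : Finset (Fin n)) : R :=
  pfList C (A.sort (· ≤ ·))

/-- For rows `a_1, …, a_r` of `U`, the coefficient of `f_A` in
`u_{a_1} ∧ ⋯ ∧ u_{a_r} ∧ C^(k)`, where `r + 2 * k = #A`:
the sum over `s_1 < ⋯ < s_r` in `A` of
`± (minor of U on the rows a and the columns s) * (Pfaffian of C on A without s_1, …, s_r)`,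
the sign being that of the shuffle which moves `s_1, …, s_r` to the front of `A`. -/
def wedge {n r : ℕ} (C : Matrix (Fin n) (Fin n) R) (U : Matrix (Fin 3) (Fin n) R)
    (A : Finset (Fin n)) (a : Fin r → Fin 3) : R :=
  ∑ s : Fin r → Fin n with (∀ i j, i < j → s i < s j) ∧ (∀ i, s i ∈ A),
    (-1) ^ (∑ i, (A.filter fun t => t < s i ∧ ∀ j, t ≠ s j).card) *
      (U.submatrix a s).det * pf C (A \ Finset.univ.image s)

end Pfaffians

/-! ### The generators and the matrices -/

section Matrices

variable {R : Type u} [CommRing R] {n : ℕ}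

/-- `n` odd: `x_1 = u_1 ∧ u_2 ∧ u_3 ∧ C^(m-1)` and `x_{k+1} = u_k ∧ C^(m)`. -/
def oddX (C : Matrix (Fin n) (Fin n) R) (U : Matrix (Fin 3) (Fin n) R) : Fin 4 → R :=
  ![wedge C U Finset.univ ![0, 1, 2], wedge C U Finset.univ ![0],
    wedge C U Finset.univ ![1], wedge C U Finset.univ ![2]]

/-- `n` even: `x_1 = C^(m)`, and `x_2, x_3, x_4` are `u_1 ∧ u_2 ∧ C^(m-1)`,
`u_1 ∧ u_3 ∧ C^(m-1)`, `u_2 ∧ u_3 ∧ C^(m-1)`. -/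
def evenX (C : Matrix (Fin n) (Fin n) R) (U : Matrix (Fin 3) (Fin n) R) : Fin 4 → R :=
  ![pf C Finset.univ, wedge C U Finset.univ ![0, 1],
    wedge C U Finset.univ ![0, 2], wedge C U Finset.univ ![1, 2]]

/-- The first `n` columns of `d_2` for `n` odd: `w_j = ± Pf(ĵ)` and
`v_{γ,j} = ∑ ± Δ_{α,β}^{k,l} Pf(ĵ, k̂, l̂)`, `{α, β, γ} = {1, 2, 3}`. -/
def oddTheta (C : Matrix (Fin n) (Fin n) R) (U : Matrix (Fin 3) (Fin n) R) :
    Matrix (Fin 4) (Fin n) R :=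
  Matrix.of ![
    fun j => (-1) ^ (j : ℕ) * pf C (Finset.univ.erase j),
    fun j => -((-1) ^ (j : ℕ) * wedge C U (Finset.univ.erase j) ![1, 2]),
    fun j => (-1) ^ (j : ℕ) * wedge C U (Finset.univ.erase j) ![0, 2],
    fun j => -((-1) ^ (j : ℕ) * wedge C U (Finset.univ.erase j) ![0, 1])]

/-- `v_{{α,β},j} = ∑ ± u_{γ,k} Pf(ĵ, k̂)` for `n` even, `{α, β, γ} = {1, 2, 3}`; the argument
is `γ`. -/
def evenV (C : Matrix (Fin n) (Fin n) R) (U : Matrix (Fin 3) (Fin n) R) (γ : Fin 3)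
    (j : Fin n) : R :=
  (-1) ^ (j : ℕ) * wedge C U (Finset.univ.erase j) ![γ]

/-- The first `n` columns of `d_2` for `n` even: `w_j = ∑ ± Δ^{k,l,p} Pf(ĵ, k̂, l̂, p̂)` and
`v_{{2,3},j}`, `-v_{{1,3},j}`, `v_{{1,2},j}`. -/
def evenTheta (C : Matrix (Fin n) (Fin n) R) (U : Matrix (Fin 3) (Fin n) R) :
    Matrix (Fin 4) (Fin n) R :=
  Matrix.of ![
    fun j => (-1) ^ (j : ℕ) * wedge C U (Finset.univ.erase j) ![0, 1, 2],
    fun j => evenV C U 0 j,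
    fun j => -evenV C U 1 j,
    fun j => evenV C U 2 j]

end Matrices

/-! ### The generic situation -/

section Generic

variable (K : Type u) [Field K] (n : ℕ)

/-- The variables: `c_{ij}` for `i < j`, and `u_{kl}`. -/
abbrev Vars (n : ℕ) : Type := {p : Fin n × Fin n // p.1 < p.2} ⊕ (Fin 3 × Fin n)

/-- The polynomial ring `R` on the entries of `C` and `U`. -/
abbrev PolyRing : Type u := MvPolynomial (Vars n) K

/-- The generic skew symmetric matrix `C` (with zero diagonal). -/
noncomputable def genC : Matrix (Fin n) (Fin n) (PolyRing K n) :=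
  Matrix.of fun i j =>
    if h : i < j then MvPolynomial.X (Sum.inl ⟨(i, j), h⟩)
    else if h : j < i then -MvPolynomial.X (Sum.inl ⟨(j, i), h⟩)
    else 0

/-- The generic `3 × n` matrix `U`. -/
noncomputable def genU : Matrix (Fin 3) (Fin n) (PolyRing K n) :=
  Matrix.of fun k l => MvPolynomial.X (Sum.inr (k, l))

/-- The matrix `d_3`: `C` on top of `U`. -/
noncomputable def genD3 : Matrix (Fin n ⊕ Fin 3) (Fin n) (PolyRing K n) :=
  Matrix.fromRows (genC K n) (genU K n)

/-- The ideal `J_n`. -/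
noncomputable def genJ : Ideal (PolyRing K n) :=
  Ideal.span (Set.range
    (if Odd n then oddX (genC K n) (genU K n) else evenX (genC K n) (genU K n)))

/-- The ring `S_n = R / J_n`. -/
abbrev RingS : Type u := PolyRing K n ⧸ genJ K n

/-- The matrix `φ_n` over `S_n`. -/
noncomputable def phi : Matrix (Fin 4) (Fin n) (RingS K n) :=
  (if Odd n then oddTheta (genC K n) (genU K n) else evenTheta (genC K n) (genU K n)).map
    (Ideal.Quotient.mk (genJ K n))

/-- The matrix `H_n`, the transpose of `φ_n`. -/
noncomputable def matH : Matrix (Fin n) (Fin 4) (RingS K n) := (phi K n).transpose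

/-- The matrix of `d_3ᵗ ⊗ S_n`. -/
noncomputable def d3tS : Matrix (Fin n) (Fin n ⊕ Fin 3) (RingS K n) :=
  (genD3 K n).transpose.map (Ideal.Quotient.mk (genJ K n))

end Generic

/-! ### The canonical module -/

section Canonical

open CategoryTheory

variable {R : Type u} [CommRing R]

/-- `Ext^c_R(R / J, R)`, the canonical module of `R / J` when `R` is a polynomial ring over a
field and `R / J` is Cohen-Macaulay of codimension `c`. -/
def ExtDual (J : Ideal R) (c : ℕ) : Type u :=
  Abelian.Ext (ModuleCat.of R (R ⧸ J)) (ModuleCat.of R R) c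

noncomputable instance (J : Ideal R) (c : ℕ) : AddCommGroup (ExtDual J c) :=
  inferInstanceAs
    (AddCommGroup (Abelian.Ext (ModuleCat.of R (R ⧸ J)) (ModuleCat.of R R) c))

noncomputable instance (J : Ideal R) (c : ℕ) : Module R (ExtDual J c) :=
  inferInstanceAs
    (Module R (Abelian.Ext (ModuleCat.of R (R ⧸ J)) (ModuleCat.of R R) c))

theorem ExtDual.isTorsionBySet (J : Ideal R) (c : ℕ) :
    Module.IsTorsionBySet R (ExtDual J c) (J : Set R) := by
  intro x r
  let M := ModuleCat.of R (R ⧸ J)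
  let y : Abelian.Ext M (ModuleCat.of R R) c := x
  change (r : R) • y = 0
  have h0 : (r : R) • (𝟙 M) = 0 := by
    ext
    change Ideal.Quotient.mk J ((r : R) * 1) = 0
    exact Ideal.Quotient.eq_zero_iff_mem.2 (J.mul_mem_right 1 r.2)
  have h1 : (r : R) • ((Abelian.Ext.mk₀ (𝟙 M)).comp y (zero_add c)) = (r : R) • y := by
    rw [Abelian.Ext.mk₀_id_comp]
  rw [← h1, ← Abelian.Ext.smul_comp, ← Abelian.Ext.mk₀_smul, h0, Abelian.Ext.mk₀_zero,
    Abelian.Ext.zero_comp]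

/-- `Ext^c_R(R / J, R)` as a module over `R / J`. -/
noncomputable instance (J : Ideal R) (c : ℕ) : Module (R ⧸ J) (ExtDual J c) :=
  (ExtDual.isTorsionBySet J c).module

instance (J : Ideal R) (c : ℕ) : IsScalarTower R (R ⧸ J) (ExtDual J c) :=
  (ExtDual.isTorsionBySet J c).isScalarTower

/-- The canonical module `ω = Ext³_R(S_n, R)` of `S_n`; `J_n` is perfect of codimension `3`. -/
abbrev Omega (K : Type u) [Field K] (n : ℕ) : Type u := ExtDual (genJ K n) 3

end Canonical

/-! ### `Hom(ω, S)` inside a free module -/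

section Dual

variable {S : Type u} [CommRing S] {ω : Type u} [AddCommGroup ω] [Module S ω]

/-- `π` is the surjection of a free presentation `S^q → S^p → ω → 0` with matrix `D`. -/
def IsPresentation {p q : Type*} [Fintype q] (D : Matrix p q S) (π : (p → S) →ₗ[S] ω) : Prop :=
  Function.Surjective π ∧ LinearMap.ker π = LinearMap.range D.mulVecLin

/-- `Hom_S(ω, S)` as a submodule of `S^p`: a homomorphism is recorded by its values on the
generators `π(e_j)` of `ω`. -/
def homIn {p : Type*} [DecidableEq p] (π : (p → S) →ₗ[S] ω) : Submodule S (p → S) where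
  carrier := {y | ∃ f : ω →ₗ[S] S, ∀ j, f (π (Pi.single j 1)) = y j}
  zero_mem' := ⟨0, fun _ => rfl⟩
  add_mem' := by
    rintro a b ⟨f, hf⟩ ⟨g, hg⟩
    exact ⟨f + g, fun j => by simp [hf, hg]⟩
  smul_mem' := by
    rintro c a ⟨f, hf⟩
    exact ⟨c • f, fun j => by simp [hf]⟩

end Dual

end AlmostCI

/-!
The canonical module `Ext³(R/J, R)` is computed from the complex
`0 → R^n → R^(n+3) → R^4 → R` with last map `d₃ = [C; U]`, and the inclusion
`im H ⊆ Hom(ω, S)` says that `d₃ * φᵗ` vanishes modulo `J`. Both rest on one device.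

Let `T` be the alternating matrix with blocks `C`, `-Uᵗ`, `U`, `0`, indexed by `n + 3` vertices.
There is a linear functional `pfaffian` on the exterior algebra of the free module on the vertices
which sends a product of basis vectors to the Pfaffian of the corresponding submatrix of `T`, and
expansion along a row reads `pfaffian (e v * x) = ∑ w, T v w * pfaffian (w ⌋ x)`
(`pfaffian_basisVec_mul`). The coefficients `[A | a]` are, up to sign, its values on
`u_{a_1} ⋯ u_{a_r} * e_A`, so that the linear Pfaffian identities needed here are this formula
together with `e v * e v = 0`. They give `d₂ d₃ = 0`, the relation `d₃ * φᵗ ≡ 0` modulo `J`, and,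
for three of the four generators `x` of `J`, a homotopy between multiplication by `x` and zero
on the complex (`nullHomotopic_odd`, `nullHomotopic_even`).

If three elements `x, y, z` of a domain act null-homotopically on the complex and have exact Koszul
complexes, then the complex is exact (`exact_of_nullHomotopic_two`,
`exact_of_nullHomotopic_three`): a cycle times `x`, times `y` and times `z` is a boundary, and
comparing the preimages allows one to divide by `x`.

Koszul exactness of the three generators follows from that of their leading forms for a weight on
the variables (`KoszulExact.of_leading`), provided the leading forms are pairwise coprime monomials.
The weight of `c_{ij}` is a strictly concave function of `i + j`, so that among the perfect
matchings of a set of vertices those with all sums `i + j` equal win. Three generators are chosen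
whose vertex sets, after deletion of the columns matched with the rows of `U`, are stable under
`i ↦ n - 1 + δ - i` (indices from `0`) for `δ = 0, 1, -1`; the three reflections
have no edge in common (`hasLeadingMonomial_of_reflection`, `koszulExact_odd`, `koszulExact_even`).

Finally `Ext³(R/J, R)` is read off the exact complex by dimension shifting
(`exists_isPresentation_extDual`).
-/

namespace AlmostCI

/-! ### Three steps of dimension shifting, and homomorphisms out of a presented module -/


section ExtDuality
open CategoryTheory Abelian

variable {R : Type u} [CommRing R]

theorem exists_ext_equiv_of_surjective {M N : Type u} [AddCommGroup M] [Module R M]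
    [AddCommGroup N] [Module R N] [Module.Projective R M] (f : M →ₗ[R] N)
    (hf : Function.Surjective f) (Y : ModuleCat.{u} R) (c : ℕ) :
    Nonempty (Ext (ModuleCat.of R (LinearMap.ker f)) Y (c + 1) ≃ₗ[R]
      Ext (ModuleCat.of R N) Y (c + 2)) := by
  let S := f.shortComplexKer
  have hS : S.ShortExact := LinearMap.shortExact_shortComplexKer hf
  have : Projective S.X₂ := (IsProjective.iff_projective M).1 inferInstance
  let g : Ext S.X₁ Y (c + 1) →ₗ[R] Ext S.X₃ Y (c + 2) :=
    Ext.precompOfLinear hS.extClass R Y (by omega)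
  refine ⟨LinearEquiv.ofBijective g ⟨?_, ?_⟩⟩
  · rw [← LinearMap.ker_eq_bot, LinearMap.ker_eq_bot']
    intro x hx
    obtain ⟨y, rfl⟩ := Ext.contravariant_sequence_exact₁ hS Y x (by omega) hx
    rw [Ext.eq_zero_of_projective y, Ext.comp_zero]
  · intro x
    exact Ext.contravariant_sequence_exact₃ hS Y x (Ext.eq_zero_of_projective _) (by omega)

/-- For `0 → A → B → N → 0` with `B` projective, `Ext¹(N, R)` is the cokernel of
`Hom(B, R) → Hom(A, R)`. -/
theorem exists_ext_one_presentation {A B N : Type u} [AddCommGroup A] [Module R A]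
    [AddCommGroup B] [Module R B] [AddCommGroup N] [Module R N] [Module.Projective R B]
    (i : A →ₗ[R] B) (f : B →ₗ[R] N) (hi : Function.Injective i) (hif : Function.Exact i f)
    (hf : Function.Surjective f) :
    ∃ p : (A →ₗ[R] R) →ₗ[R] Ext (ModuleCat.of R N) (ModuleCat.of R R) 1,
      Function.Surjective p ∧ ∀ a, p a = 0 ↔ ∃ b : B →ₗ[R] R, b ∘ₗ i = a := by
  let S : ShortComplex (ModuleCat.{u} R) :=
    ShortComplex.mk (ModuleCat.ofHom i) (ModuleCat.ofHom f)
      (by ext x; exact hif.apply_apply_eq_zero x)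
  have hS : S.ShortExact :=
    { exact := (ShortComplex.ShortExact.moduleCat_exact_iff_function_exact S).2 hif
      mono_f := (ModuleCat.mono_iff_injective _).2 hi
      epi_g := (ModuleCat.epi_iff_surjective _).2 hf }
  have : Projective S.X₂ := (IsProjective.iff_projective B).1 inferInstance
  let Y := ModuleCat.of R R
  let e : Ext S.X₁ Y 0 ≃ₗ[R] (A →ₗ[R] R) := (Ext.linearEquiv₀ (R := R)).trans
    (ModuleCat.homLinearEquiv (S := R))
  have he : ∀ a, e.symm a = Ext.mk₀ (X := S.X₁) (Y := Y) (ModuleCat.ofHom a) := fun a => by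
    rfl
  refine ⟨(Ext.precompOfLinear hS.extClass R Y (by omega)) ∘ₗ e.symm.toLinearMap, ?_, ?_⟩
  · refine Function.Surjective.comp (g := Ext.precompOfLinear hS.extClass R Y (by omega))
      (fun x => ?_) e.symm.surjective
    exact Ext.contravariant_sequence_exact₃ hS Y x (Ext.eq_zero_of_projective _) (by omega)
  · intro a
    constructor
    · intro h
      obtain ⟨y, hy⟩ := Ext.contravariant_sequence_exact₁ hS Y (e.symm a) (by omega) h
      obtain ⟨b, rfl⟩ := (Ext.mk₀_bijective S.X₂ Y).2 y
      refine ⟨b.hom, ?_⟩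
      rw [Ext.mk₀_comp_mk₀, he] at hy
      have := (Ext.mk₀_bijective S.X₁ Y).1 hy
      exact congrArg ModuleCat.Hom.hom this
    · rintro ⟨b, rfl⟩
      change hS.extClass.comp (e.symm (b ∘ₗ i)) (by omega : 1 + 0 = 1) = 0
      have : e.symm (b ∘ₗ i) = (Ext.mk₀ S.f).comp
          (Ext.mk₀ (X := S.X₂) (Y := Y) (ModuleCat.ofHom b)) (zero_add 0) := by
        rw [he, Ext.mk₀_comp_mk₀]; rfl
      rw [this, hS.extClass_comp_assoc]

/-- If `0 → F₃ → F₂ → F₁ → R → R/J → 0` is exact with `F₁`, `F₂` projective, then `Ext³(R/J, R)`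
is the cokernel of the dual of `d₃`. -/
theorem exists_extDual_three_presentation {F₁ F₂ F₃ : Type u} [AddCommGroup F₁] [Module R F₁]
    [AddCommGroup F₂] [Module R F₂] [AddCommGroup F₃] [Module R F₃] [Module.Projective R F₁]
    [Module.Projective R F₂] (J : Ideal R) (d₁ : F₁ →ₗ[R] R) (d₂ : F₂ →ₗ[R] F₁)
    (d₃ : F₃ →ₗ[R] F₂) (h₀ : LinearMap.range d₁ = J) (h₁ : Function.Exact d₂ d₁)
    (h₂ : Function.Exact d₃ d₂) (h₃ : Function.Injective d₃) :
    ∃ p : (F₃ →ₗ[R] R) →ₗ[R] ExtDual J 3,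
      Function.Surjective p ∧ ∀ a, p a = 0 ↔ ∃ b : F₂ →ₗ[R] R, b ∘ₗ d₃ = a := by
  let Y := ModuleCat.of R R
  let f₁ : F₁ →ₗ[R] LinearMap.ker J.mkQ := d₁.codRestrict _ fun x => by
    rw [Submodule.ker_mkQ, ← h₀]; exact ⟨x, rfl⟩
  have hf₁ : Function.Surjective f₁ := by
    rintro ⟨y, hy⟩
    rw [Submodule.ker_mkQ, ← h₀] at hy
    obtain ⟨x, rfl⟩ := hy
    exact ⟨x, rfl⟩
  have hker : LinearMap.ker f₁ = LinearMap.ker d₁ := LinearMap.ker_codRestrict _ _ _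
  let f₂ : F₂ →ₗ[R] LinearMap.ker f₁ := d₂.codRestrict _ fun x => by
    rw [hker]; exact h₁.apply_apply_eq_zero x
  have hf₂ : Function.Surjective f₂ := by
    rintro ⟨y, hy⟩
    rw [hker] at hy
    obtain ⟨x, rfl⟩ := (h₁ y).1 hy
    exact ⟨x, rfl⟩
  have hex : Function.Exact d₃ f₂ := by
    intro x
    rw [← h₂ x]
    exact Subtype.ext_iff
  obtain ⟨p, hp, hp'⟩ := exists_ext_one_presentation d₃ f₂ h₃ hex hf₂
  obtain ⟨e₁⟩ := exists_ext_equiv_of_surjective f₁ hf₁ Y 0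
  obtain ⟨e₂⟩ := exists_ext_equiv_of_surjective J.mkQ J.mkQ_surjective Y 1
  refine ⟨(e₁.trans e₂).toLinearMap ∘ₗ p, (e₁.trans e₂).surjective.comp hp, fun a => ?_⟩
  rw [← hp']
  exact (e₁.trans e₂).map_eq_zero_iff

/-- As `J` annihilates `Ext³(R/J, R)`, a presentation over `R` reduces to one over `R/J`. -/
theorem exists_isPresentation_extDual {p q : Type} {F₁ : Type u} [Fintype p] [DecidableEq p] [Fintype q]
    [DecidableEq q] [AddCommGroup F₁] [Module R F₁] [Module.Projective R F₁] (J : Ideal R)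
    (d₁ : F₁ →ₗ[R] R) (d₂ : (q → R) →ₗ[R] F₁) (D : Matrix q p R)
    (h₀ : LinearMap.range d₁ = J) (h₁ : Function.Exact d₂ d₁)
    (h₂ : Function.Exact D.mulVecLin d₂) (h₃ : Function.Injective D.mulVecLin) :
    ∃ π : (p → R ⧸ J) →ₗ[R ⧸ J] ExtDual J 3,
      IsPresentation (D.transpose.map (Ideal.Quotient.mk J)) π := by
  obtain ⟨P, hP, hP'⟩ := exists_extDual_three_presentation J d₁ d₂ D.mulVecLin h₀ h₁ h₂ h₃
  let v : p → ExtDual J 3 := fun j => P (LinearMap.proj j)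
  let π : (p → R ⧸ J) →ₗ[R ⧸ J] ExtDual J 3 := Fintype.linearCombination (R ⧸ J) v
  have hmk : ∀ r : p → R, π (fun j => Ideal.Quotient.mk J (r j)) =
      P (∑ j, r j • LinearMap.proj j) := by
    intro r
    rw [map_sum]
    simp only [π, Fintype.linearCombination_apply, map_smul]
    refine Finset.sum_congr rfl fun j _ => ?_
    exact algebraMap_smul (R ⧸ J) (r j) (v j)
  have hlift : ∀ {ι : Type} (s : ι → R ⧸ J), ∃ r : ι → R,
      (fun j => Ideal.Quotient.mk J (r j)) = s := fun s =>
    ⟨fun j => (s j).out, funext fun j => Ideal.Quotient.mk_out (s j)⟩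
  have hdual : ∀ (r : p → R), (∃ b : (q → R) →ₗ[R] R, b ∘ₗ D.mulVecLin =
      ∑ j, r j • LinearMap.proj j) ↔ ∃ b : q → R, D.transpose.mulVec b = r := by
    intro r
    have hr : ∀ j, (∑ i, r i • (LinearMap.proj i : (p → R) →ₗ[R] R)) (Pi.single j 1) = r j := by
      intro j
      simp [Pi.single_apply]
    constructor
    · rintro ⟨b, hb⟩
      refine ⟨fun i => b (Pi.single i 1), funext fun j => ?_⟩
      rw [← hr j, ← hb]
      simp only [LinearMap.comp_apply, Matrix.mulVecLin_apply, Matrix.mulVec_single_one]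
      conv_rhs => rw [pi_eq_sum_univ' (D.col j), map_sum]
      simp only [map_smul, Matrix.mulVec, dotProduct, Matrix.transpose_apply, Matrix.col_apply,
        smul_eq_mul]
    · rintro ⟨b, rfl⟩
      refine ⟨∑ i, b i • LinearMap.proj i, LinearMap.pi_ext' fun j => LinearMap.ext_ring ?_⟩
      simp only [LinearMap.comp_apply, LinearMap.single_apply]
      rw [hr j]
      simp [LinearMap.sum_apply, Matrix.mulVec, dotProduct, mul_comm]
  refine ⟨π, fun x => ?_, ?_⟩
  · obtain ⟨a, rfl⟩ := hP x
    refine ⟨fun j => Ideal.Quotient.mk J (a (Pi.single j 1)), ?_⟩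
    rw [hmk]
    congr 1
    refine LinearMap.pi_ext' fun j => LinearMap.ext_ring ?_
    simp [Pi.single_apply]
  · ext s
    obtain ⟨r, rfl⟩ := hlift s
    rw [LinearMap.mem_ker, hmk, hP', hdual]
    constructor
    · rintro ⟨b, rfl⟩
      refine ⟨fun i => Ideal.Quotient.mk J (b i), funext fun j => ?_⟩
      simp [Matrix.mulVec, dotProduct]
    · rintro ⟨t, ht⟩
      obtain ⟨b, rfl⟩ := hlift t
      -- `r` agrees with `Dᵗ b` modulo `J`, and `J` kills the `Ext` module
      have h0 : π (fun j => Ideal.Quotient.mk J (r j)) =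
          π (fun j => Ideal.Quotient.mk J (D.transpose.mulVec b j)) := by
        congr 1
        rw [← ht]
        funext j
        simp [Matrix.mulVec, dotProduct]
      rw [← hdual, ← hP', ← hmk, h0, hmk, hP', hdual]
      exact ⟨b, rfl⟩

end ExtDuality

section HomIn

variable {S : Type u} [CommRing S] {ω : Type u} [AddCommGroup ω] [Module S ω]

theorem range_mulVecLin_le_homIn {p q r : Type*} [Fintype p] [DecidableEq p] [Fintype q]
    [Fintype r] {D : Matrix p q S} {π : (p → S) →ₗ[S] ω} (hπ : IsPresentation D π)
    (H : Matrix p r S) (hH : D.transpose * H = 0) :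
    LinearMap.range H.mulVecLin ≤ homIn π := by
  rintro _ ⟨c, rfl⟩
  let y := H.mulVec c
  have hy : D.transpose.mulVec y = 0 := by
    simp only [y, Matrix.mulVec_mulVec, hH, Matrix.zero_mulVec]
  let g : (p → S) →ₗ[S] S := ∑ j, y j • LinearMap.proj j
  have hg : ∀ v, g v = y ⬝ᵥ v := fun v => by simp [g, LinearMap.sum_apply, dotProduct]
  have hker : LinearMap.ker π ≤ LinearMap.ker g := by
    rw [hπ.2]
    rintro _ ⟨t, rfl⟩
    rw [LinearMap.mem_ker, hg, Matrix.mulVecLin_apply, Matrix.dotProduct_mulVec,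
      ← Matrix.mulVec_transpose, hy, zero_dotProduct]
  refine ⟨(LinearMap.ker π).liftQ g hker ∘ₗ (π.quotKerEquivOfSurjective hπ.1).symm.toLinearMap,
    fun j => ?_⟩
  have : (π.quotKerEquivOfSurjective hπ.1).symm (π (Pi.single j 1)) =
      (LinearMap.ker π).mkQ (Pi.single j 1) := by
    rw [LinearEquiv.symm_apply_eq]; rfl
  simp only [LinearMap.comp_apply, LinearEquiv.coe_coe, this, Submodule.mkQ_apply,
    Submodule.liftQ_apply, hg, dotProduct_single_one, Matrix.mulVecLin_apply, y]

end HomIn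

/-! ### An acyclicity criterion for complexes of length three -/


section Acyclicity

variable {R : Type u} [CommRing R]

/-- Every linear relation among the `x i` is a combination of the relations
`x j * x i - x i * x j = 0`: exactness of the Koszul complex in degree one. The coefficient matrix
is required to be alternating, with zero diagonal, so that the notion is right in
characteristic two. -/
def KoszulExact {ι : Type*} [Fintype ι] (x : ι → R) : Prop :=
  ∀ a : ι → R, ∑ i, x i * a i = 0 → ∃ p : ι → ι → R,
    (∀ i, p i i = 0) ∧ (∀ i j, p i j = -p j i) ∧ ∀ i, a i = ∑ j, p i j * x j

/-- `(h₀, h₁, h₂)` is a homotopy from multiplication by `x` to zero on the complex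
`0 → R^n → R^q → R^m → R` with differentials `d₃`, `d₂`, `d₁`; the row `d₁` is a vector. -/
structure IsHomotopy {m q n : Type*} [Fintype m] [DecidableEq m] [Fintype q] [DecidableEq q]
    [Fintype n] [DecidableEq n] (d₁ : m → R) (d₂ : Matrix m q R) (d₃ : Matrix q n R)
    (x : R) (h₀ : m → R) (h₁ : Matrix q m R) (h₂ : Matrix n q R) : Prop where
  zero : d₁ ⬝ᵥ h₀ = x
  one : ∀ i j, h₀ i * d₁ j + (d₂ * h₁) i j = if i = j then x else 0
  two : h₁ * d₂ + d₃ * h₂ = x • 1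
  three : h₂ * d₃ = x • 1

/-- Multiplication by `x` is null-homotopic on the complex with differentials `d₃`, `d₂`, `d₁`. -/
def NullHomotopic {m q n : Type*} [Fintype m] [DecidableEq m] [Fintype q] [DecidableEq q]
    [Fintype n] [DecidableEq n] (d₁ : m → R) (d₂ : Matrix m q R) (d₃ : Matrix q n R)
    (x : R) : Prop :=
  ∃ h₀ h₁ h₂, IsHomotopy d₁ d₂ d₃ x h₀ h₁ h₂

variable {m q n : Type*} [Fintype m] [DecidableEq m] [Fintype q] [DecidableEq q]
    [Fintype n] [DecidableEq n] {d₁ : m → R} {d₂ : Matrix m q R} {d₃ : Matrix q n R} {x : R}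

theorem NullHomotopic.exists_of_mulVec_eq_zero (h : NullHomotopic d₁ d₂ d₃ x) {a : q → R}
    (ha : d₂.mulVec a = 0) : ∃ b, d₃.mulVec b = x • a := by
  obtain ⟨h₀, h₁, h₂, h⟩ := h
  refine ⟨h₂.mulVec a, ?_⟩
  have := congrArg (fun M => Matrix.mulVec M a) h.two
  simpa [Matrix.add_mulVec, ← Matrix.mulVec_mulVec, ha, Matrix.smul_mulVec] using this

theorem NullHomotopic.exists_of_dotProduct_eq_zero (h : NullHomotopic d₁ d₂ d₃ x) {a : m → R}
    (ha : d₁ ⬝ᵥ a = 0) : ∃ b, d₂.mulVec b = x • a := by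
  obtain ⟨h₀, h₁, h₂, h⟩ := h
  refine ⟨h₁.mulVec a, funext fun i => ?_⟩
  have h1 : ∑ j, (h₀ i * d₁ j + (d₂ * h₁) i j) * a j = x * a i := by
    simp [h.one]
  simp only [add_mul, Finset.sum_add_distrib, mul_assoc, ← Finset.mul_sum] at h1
  change h₀ i * (d₁ ⬝ᵥ a) + ((d₂ * h₁).mulVec a) i = _ at h1
  rw [ha, mul_zero, zero_add] at h1
  rw [Matrix.mulVec_mulVec, h1]; rfl

theorem NullHomotopic.mulVec_injective [IsDomain R] (h : NullHomotopic d₁ d₂ d₃ x)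
    (hx : x ≠ 0) : Function.Injective d₃.mulVec := by
  obtain ⟨h₀, h₁, h₂, h⟩ := h
  intro a b hab
  have h1 : ∀ c, h₂.mulVec (d₃.mulVec c) = x • c := fun c => by
    rw [Matrix.mulVec_mulVec, h.three, Matrix.smul_mulVec, Matrix.one_mulVec]
  have h2 : x • a = x • b := by rw [← h1, ← h1, hab]
  exact smul_right_injective _ hx h2

/-- A null-homotopy forces `d₁ d₂ = 0` over a domain. -/
theorem NullHomotopic.vecMul_eq_zero [IsDomain R] (h : NullHomotopic d₁ d₂ d₃ x) (hx : x ≠ 0)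
    (h32 : d₂ * d₃ = 0) : Matrix.vecMul d₁ d₂ = 0 := by
  obtain ⟨h₀, h₁, h₂, h⟩ := h
  have e1 : Matrix.vecMul d₁ (d₂ * h₁) = 0 := by
    funext j
    have h1 : ∑ i, d₁ i * (h₀ i * d₁ j + (d₂ * h₁) i j) = d₁ j * x := by
      simp [h.one]
    simp only [mul_add, Finset.sum_add_distrib, ← mul_assoc, ← Finset.sum_mul] at h1
    change (d₁ ⬝ᵥ h₀) * d₁ j + Matrix.vecMul d₁ (d₂ * h₁) j = _ at h1
    rw [h.zero] at h1
    simpa [mul_comm x] using h1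
  have e2 : x • Matrix.vecMul d₁ d₂ = 0 := by
    have := congrArg (fun M => Matrix.vecMul d₁ (d₂ * M)) h.two
    rw [Matrix.mul_add, ← Matrix.mul_assoc, ← Matrix.mul_assoc, h32, Matrix.zero_mul, add_zero,
      ← Matrix.vecMul_vecMul, e1, Matrix.zero_vecMul] at this
    rw [Matrix.mul_smul, Matrix.mul_one, Matrix.vecMul_smul] at this
    exact this.symm
  exact (smul_eq_zero.1 e2).resolve_left hx

theorem KoszulExact.exists_eq_mul {x y a b : R} (h : KoszulExact ![x, y])
    (hab : x * a = y * b) : ∃ c, b = x * c ∧ a = y * c := by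
  obtain ⟨p, hp, hp', h⟩ := h ![a, -b] (by simp [Fin.sum_univ_two, hab])
  have h0 := h 0
  have h1 := h 1
  simp only [Fin.sum_univ_two, hp, Matrix.cons_val_zero, Matrix.cons_val_one, zero_mul,
    zero_add, add_zero] at h0 h1
  refine ⟨p 0 1, ?_, by rw [h0]; ring⟩
  rw [hp'] at h1
  linear_combination -h1

/-- Exactness at the term `R^q`. -/
theorem exact_of_nullHomotopic_two [IsDomain R] {y : R} (hx : NullHomotopic d₁ d₂ d₃ x)
    (hy : NullHomotopic d₁ d₂ d₃ y) (hxy : KoszulExact ![x, y]) (hx0 : x ≠ 0) {a : q → R}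
    (ha : d₂.mulVec a = 0) : ∃ b, d₃.mulVec b = a := by
  obtain ⟨b, hb⟩ := hx.exists_of_mulVec_eq_zero ha
  obtain ⟨c, hc⟩ := hy.exists_of_mulVec_eq_zero ha
  have h1 : x • c = y • b := by
    apply hx.mulVec_injective hx0
    rw [Matrix.mulVec_smul, Matrix.mulVec_smul, hb, hc, smul_comm]
  choose e he he' using fun i => hxy.exists_eq_mul (congrFun h1 i)
  refine ⟨e, smul_right_injective _ hx0 ?_⟩
  have : b = x • e := funext he
  simp only
  rw [← hb, this, Matrix.mulVec_smul]

/-- Exactness at the term `R^m`. -/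
theorem exact_of_nullHomotopic_three [IsDomain R] {y z : R} (hx : NullHomotopic d₁ d₂ d₃ x)
    (hy : NullHomotopic d₁ d₂ d₃ y) (hz : NullHomotopic d₁ d₂ d₃ z) (h32 : d₂ * d₃ = 0)
    (hxy : KoszulExact ![x, y]) (hxyz : KoszulExact ![x, y, z]) (hx0 : x ≠ 0) {a : m → R}
    (ha : d₁ ⬝ᵥ a = 0) : ∃ b, d₂.mulVec b = a := by
  obtain ⟨b₁, hb₁⟩ := hx.exists_of_dotProduct_eq_zero ha
  obtain ⟨b₂, hb₂⟩ := hy.exists_of_dotProduct_eq_zero ha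
  obtain ⟨b₃, hb₃⟩ := hz.exists_of_dotProduct_eq_zero ha
  have key : ∀ {s t : R} {b c : q → R}, d₂.mulVec b = s • a → d₂.mulVec c = t • a →
      ∃ e, d₃.mulVec e = s • c - t • b := by
    intro s t b c hb hc
    apply exact_of_nullHomotopic_two hx hy hxy hx0
    rw [Matrix.mulVec_sub, Matrix.mulVec_smul, Matrix.mulVec_smul, hb, hc, smul_comm, sub_self]
  obtain ⟨c₁₂, h₁₂⟩ := key hb₁ hb₂
  obtain ⟨c₁₃, h₁₃⟩ := key hb₁ hb₃
  obtain ⟨c₂₃, h₂₃⟩ := key hb₂ hb₃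
  have hs : x • c₂₃ - y • c₁₃ + z • c₁₂ = 0 := by
    apply hx.mulVec_injective hx0
    rw [Matrix.mulVec_add, Matrix.mulVec_sub, Matrix.mulVec_smul, Matrix.mulVec_smul,
      Matrix.mulVec_smul, h₁₂, h₁₃, h₂₃, Matrix.mulVec_zero]
    funext i
    simp only [Pi.add_apply, Pi.sub_apply, Pi.smul_apply, smul_eq_mul, Pi.zero_apply]
    ring
  -- the third component of the Koszul relation puts `c₁₂` into `(x, y)`
  have hc : ∀ i, ∃ e f, c₁₂ i = x * e + y * f := by
    intro i
    obtain ⟨p, hp, -, h⟩ := hxyz ![c₂₃ i, -c₁₃ i, c₁₂ i] (by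
      have := congrFun hs i
      simp only [Pi.add_apply, Pi.sub_apply, Pi.smul_apply, smul_eq_mul, Pi.zero_apply] at this
      simp [Fin.sum_univ_three, ← this, sub_eq_add_neg])
    refine ⟨p 2 0, p 2 1, ?_⟩
    have := h 2
    simp only [Fin.sum_univ_three, hp] at this
    simpa [mul_comm] using this
  choose e f hef using hc
  have hef' : c₁₂ = x • e + y • f := funext hef
  have h1 : x • (b₂ - d₃.mulVec e) = y • (b₁ + d₃.mulVec f) := by
    rw [hef', Matrix.mulVec_add, Matrix.mulVec_smul, Matrix.mulVec_smul] at h₁₂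
    rw [smul_sub, smul_add, sub_eq_iff_eq_add]
    rw [eq_sub_iff_add_eq] at h₁₂
    rw [← h₁₂]; abel
  choose g hg hg' using fun i => hxy.exists_eq_mul (congrFun h1 i)
  have hg2 : b₁ + d₃.mulVec f = x • g := funext hg
  refine ⟨g, smul_right_injective _ hx0 ?_⟩
  simp only
  rw [← Matrix.mulVec_smul, ← hg2, Matrix.mulVec_add, hb₁, Matrix.mulVec_mulVec, h32,
    Matrix.zero_mulVec, add_zero]

end Acyclicity

/-! ### The Pfaffian as a linear functional on the exterior algebra -/


section PfaffianFunctional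

variable {R : Type u} [CommRing R] {V : Type*}

/-- Skew symmetry with zero diagonal; the second condition implies the first unless `2` is a zero
divisor. -/
structure IsAlternating (T : Matrix V V R) : Prop where
  diag : ∀ i, T i i = 0
  neg : ∀ i j, T i j = -T j i

/-- Contraction with the coordinate form of the vertex `v`. -/
noncomputable def contract (v : V) : ExteriorAlgebra R (V → R) →ₗ[R] ExteriorAlgebra R (V → R) :=
  CliffordAlgebra.contractLeft (Q := (0 : QuadraticForm R (V → R))) (LinearMap.proj v)

@[simp]
theorem contract_one (v : V) : contract v (1 : ExteriorAlgebra R (V → R)) = 0 :=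
  CliffordAlgebra.contractLeft_one _ _

theorem contract_contract_comm (v w : V) (x : ExteriorAlgebra R (V → R)) :
    contract v (contract w x) = -contract w (contract v x) :=
  CliffordAlgebra.contractLeft_comm _ _ _

variable [DecidableEq V]

theorem IsAlternating.toQuadraticMap_toBilin_neg [Fintype V] {T : Matrix V V R} (hT : IsAlternating T) :
    (Matrix.toBilin' (-T)).toQuadraticMap = (0 : QuadraticForm R (V → R)) - 0 := by
  rw [sub_zero, LinearMap.BilinMap.toQuadraticMap_eq_zero]
  intro v
  rw [Matrix.toBilin'_apply, ← Finset.sum_product']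
  refine Finset.sum_involution (fun p _ => p.swap) (fun p _ => ?_) (fun p _ hp h => hp ?_)
    (fun p _ => by simp) (fun p _ => Prod.swap_swap p)
  · simp only [Prod.fst_swap, Prod.snd_swap, Matrix.neg_apply]
    rw [hT.neg p.1 p.2]; ring
  · have : p.1 = p.2 := congrArg Prod.snd h
    rw [this, Matrix.neg_apply, hT.diag]; ring

/-- The basis vector of the vertex `v`, in the exterior algebra of the free module on `V`. -/
noncomputable def basisVec (R : Type u) [CommRing R] (v : V) : ExteriorAlgebra R (V → R) :=
  ExteriorAlgebra.ι R (Pi.single v 1)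

/-- The linear functional on the exterior algebra whose value on a product of basis vectors is the
Pfaffian of the corresponding submatrix of `T` (`pfaffian_prod_map`). It is the constant term after
the change of form of Clifford algebras by `-T`; this is possible over any ring, because the
quadratic form of an alternating matrix is zero, and makes alternation in the vertices automatic. -/
noncomputable def pfaffian [Fintype V] {T : Matrix V V R} (hT : IsAlternating T) :
    ExteriorAlgebra R (V → R) →ₗ[R] R :=
  ExteriorAlgebra.algebraMapInv.toLinearMap ∘ₗ
    CliffordAlgebra.changeForm hT.toQuadraticMap_toBilin_neg

theorem contract_basisVec_mul (v w : V) (x : ExteriorAlgebra R (V → R)) :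
    contract v (basisVec R w * x) =
      (if v = w then x else 0) - basisVec R w * contract v x := by
  have := CliffordAlgebra.contractLeft_ι_mul (Q := (0 : QuadraticForm R (V → R)))
    (LinearMap.proj v) (Pi.single w 1) x
  simp only [LinearMap.proj_apply, Pi.single_apply, ite_smul, one_smul, zero_smul] at this
  exact this

@[simp]
theorem basisVec_mul_self (v : V) : basisVec R v * basisVec R v = 0 :=
  ExteriorAlgebra.ι_sq_zero _

@[simp]
theorem basisVec_mul_self_mul (v : V) (x : ExteriorAlgebra R (V → R)) :
    basisVec R v * (basisVec R v * x) = 0 := by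
  rw [← mul_assoc, basisVec_mul_self, zero_mul]

theorem basisVec_mul_swap (v w : V) : basisVec R v * basisVec R w = -(basisVec R w * basisVec R v) :=
  eq_neg_of_add_eq_zero_left (ExteriorAlgebra.ι_add_mul_swap _ _)

theorem basisVec_mul_swap_mul (v w : V) (x : ExteriorAlgebra R (V → R)) :
    basisVec R v * (basisVec R w * x) = -(basisVec R w * (basisVec R v * x)) := by
  rw [← mul_assoc, basisVec_mul_swap, neg_mul, mul_assoc]

variable [Fintype V] {T : Matrix V V R} (hT : IsAlternating T)

@[simp]
theorem pfaffian_one : pfaffian hT 1 = 1 := by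
  change ExteriorAlgebra.algebraMapInv (CliffordAlgebra.changeForm _ 1) = 1
  rw [CliffordAlgebra.changeForm_one]
  exact map_one _

theorem pfaffian_ι_mul (m : V → R) (x : ExteriorAlgebra R (V → R)) :
    pfaffian hT (ExteriorAlgebra.ι R m * x) = pfaffian hT
      (CliffordAlgebra.contractLeft (Q := (0 : QuadraticForm R (V → R)))
        (Matrix.toBilin' T m) x) := by
  change ExteriorAlgebra.algebraMapInv (CliffordAlgebra.changeForm _ (CliffordAlgebra.ι _ m * x))
    = ExteriorAlgebra.algebraMapInv (CliffordAlgebra.changeForm _ _)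
  rw [CliffordAlgebra.changeForm_ι_mul, CliffordAlgebra.changeForm_contractLeft, map_sub]
  have h1 : ∀ y : ExteriorAlgebra R (V → R), ExteriorAlgebra.algebraMapInv
      (CliffordAlgebra.ι (0 : QuadraticForm R (V → R)) m * y) = 0 := fun y => by
    rw [map_mul]
    have : ExteriorAlgebra.algebraMapInv (CliffordAlgebra.ι (0 : QuadraticForm R (V → R)) m) = 0 := by
      simp only [ExteriorAlgebra.algebraMapInv]
      exact (ExteriorAlgebra.lift_ι_apply R _ _ m).trans rfl
    rw [this, zero_mul]
  have h2 : Matrix.toBilin' (-T) m = -Matrix.toBilin' T m := by rw [map_neg]; rfl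
  rw [h1, h2, map_neg, LinearMap.neg_apply, map_neg, sub_neg_eq_add, zero_add]

/-- Expansion of a Pfaffian along its first row. -/
theorem pfaffian_basisVec_mul (v : V) (x : ExteriorAlgebra R (V → R)) :
    pfaffian hT (basisVec R v * x) = ∑ w, T v w * pfaffian hT (contract w x) := by
  have h : Matrix.toBilin' T (Pi.single v 1) = ∑ w, T v w • LinearMap.proj w := by
    refine LinearMap.pi_ext' fun j => LinearMap.ext_ring ?_
    simp [Matrix.toBilin'_apply, Pi.single_apply]
  rw [basisVec, pfaffian_ι_mul, h, map_sum, LinearMap.sum_apply, map_sum]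
  refine Finset.sum_congr rfl fun w _ => ?_
  rw [map_smul, LinearMap.smul_apply, map_smul]
  rfl

theorem contractLeft_prod_map_ι {M : Type*} [AddCommGroup M] [Module R M] {κ : Type*} (e : κ → M)
    (d : Module.Dual R M) (l : List κ) :
    CliffordAlgebra.contractLeft (Q := (0 : QuadraticForm R M)) d
        (l.map fun i => ExteriorAlgebra.ι R (e i)).prod =
      ∑ k : Fin l.length, ((-1) ^ (k : ℕ) * d (e (l.get k))) •
        ((l.eraseIdx k).map fun i => ExteriorAlgebra.ι R (e i)).prod := by
  induction l with
  | nil => simp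
  | cons a l ih =>
    rw [List.map_cons, List.prod_cons]
    erw [CliffordAlgebra.contractLeft_ι_mul]
    rw [ih]
    simp only [List.length_cons]
    rw [Fin.sum_univ_succ, Finset.mul_sum, sub_eq_add_neg, ← Finset.sum_neg_distrib]
    congr 1
    · simp
    · refine Finset.sum_congr rfl fun k _ => ?_
      simp only [Fin.val_succ, List.eraseIdx_cons_succ, List.map_cons,
        List.prod_cons, pow_succ, mul_neg, mul_one, neg_mul, neg_smul]
      congr 1
      exact mul_smul_comm _ _ _

theorem pfaffian_prod_map {κ : Type*} (e : κ → V) (l : List κ) :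
    pfaffian hT (l.map fun i => basisVec R (e i)).prod = pfList (T.submatrix e e) l := by
  induction hl : l.length using Nat.strong_induction_on generalizing l with
  | _ N ih =>
    subst hl
    cases l with
    | nil => simp [pfList]
    | cons i l =>
      rw [pfList, List.map_cons, List.prod_cons]
      conv_lhs => rw [basisVec]
      rw [pfaffian_ι_mul]
      have := contractLeft_prod_map_ι (fun i => (Pi.single (e i) 1 : V → R))
        (Matrix.toBilin' T (Pi.single (e i) 1)) l
      erw [this]
      rw [map_sum]
      refine Finset.sum_congr rfl fun k _ => ?_
      rw [map_smul, smul_eq_mul]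
      congr 1
      · congr 1
        rw [Matrix.toBilin'_single]; rfl
      · exact ih _ (by have h := List.length_eraseIdx_le l (k : ℕ); simp only [List.length_cons]; omega) _ rfl

end PfaffianFunctional

/-! ### The coefficients `wedge` as values of the Pfaffian functional -/


section Wedge

variable {R : Type u} [CommRing R] {n : ℕ}

/-- Among the elements of `A` below `s i`, exactly `i` are values of `s`. -/
theorem card_filter_lt_eq_add {r : ℕ} {A : Finset (Fin n)} {s : Fin (r + 1) → Fin n}
    (hs : StrictMono s) (hA : ∀ i, s i ∈ A) (i : Fin (r + 1)) :
    (A.filter (· < s i)).card = (A.filter fun t => t < s i ∧ ∀ j, t ≠ s j).card + i := by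
  have h1 : ((Finset.Iio i).map ⟨s, hs.injective⟩).card = i := by
    rw [Finset.card_map, Fin.card_Iio]
  conv_rhs => rw [← h1]
  rw [← Finset.card_union_of_disjoint]
  · congr 1
    ext t
    simp only [Finset.mem_filter, Finset.mem_union, Finset.mem_map, Finset.mem_Iio,
      Function.Embedding.coeFn_mk]
    constructor
    · rintro ⟨ht, hlt⟩
      by_cases h : ∃ j, s j = t
      · obtain ⟨j, rfl⟩ := h
        exact Or.inr ⟨j, hs.lt_iff_lt.1 hlt, rfl⟩
      · push Not at h
        exact Or.inl ⟨ht, hlt, fun j => (h j).symm⟩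
    · rintro (⟨ht, hlt, -⟩ | ⟨j, hj, rfl⟩)
      · exact ⟨ht, hlt⟩
      · exact ⟨hA j, hs hj⟩
  · rw [Finset.disjoint_left]
    intro t ht ht'
    obtain ⟨j, -, rfl⟩ := Finset.mem_map.1 ht'
    exact (Finset.mem_filter.1 ht).2.2 j rfl

/-- Laplace expansion of the minors of `U` along their first row. -/
theorem wedge_succ {r : ℕ} (C : Matrix (Fin n) (Fin n) R) (U : Matrix (Fin 3) (Fin n) R)
    (A : Finset (Fin n)) (a : Fin (r + 1) → Fin 3) :
    wedge C U A a = ∑ x ∈ A, (-1) ^ (A.filter (· < x)).card *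
      (U (a 0) x * wedge C U (A.erase x) (fun i => a i.succ)) := by
  unfold wedge
  simp only [Matrix.det_succ_row_zero, Finset.mul_sum, Finset.sum_mul]
  rw [← Finset.sum_product', Finset.sum_sigma']
  refine Finset.sum_bij (fun p _ => ⟨p.1 p.2, fun k => p.1 (p.2.succAbove k)⟩) ?_ ?_ ?_ ?_
  · rintro ⟨s, i⟩ h
    simp only [Finset.mem_product, Finset.mem_filter, Finset.mem_univ, true_and, and_true,
      Finset.mem_sigma, Finset.mem_erase] at h ⊢
    have hs : StrictMono s := fun i j h' => h.1 i j h'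
    exact ⟨h.2 i, fun k l hkl => hs (Fin.strictMono_succAbove i hkl), fun k =>
      ⟨hs.injective.ne (Fin.succAbove_ne i k), h.2 _⟩⟩
  · rintro ⟨s, i⟩ h ⟨t, j⟩ h' heq
    simp only [Finset.mem_product, Finset.mem_filter, Finset.mem_univ, true_and, and_true] at h h'
    have hs : StrictMono s := fun i j h' => h.1 i j h'
    have ht : StrictMono t := fun i j h => h'.1 i j h
    simp only [Sigma.mk.injEq] at heq
    obtain ⟨h1, h2⟩ := heq
    have h2 := eq_of_heq h2
    have hr : ∀ (s : Fin (r + 1) → Fin n) (i : Fin (r + 1)), Set.range s =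
        insert (s i) (Set.range fun k => s (i.succAbove k)) := by
      intro s i
      ext y
      simp only [Set.mem_range, Set.mem_insert_iff, eq_comm (b := y), Fin.exists_iff_succAbove i]
    have hst : s = t := by
      rw [← StrictMono.range_inj hs ht, hr s i, hr t j, h1, h2]
    subst hst
    exact Prod.ext rfl (hs.injective h1)
  · rintro ⟨x, s⟩ h
    simp only [Finset.mem_filter, Finset.mem_univ, true_and,
      Finset.mem_sigma, Finset.mem_erase] at h
    obtain ⟨hx, hs, hsA⟩ := h
    have hs : StrictMono s := fun i j h' => hs i j h'
    let B : Finset (Fin n) := insert x (Finset.univ.map ⟨s, hs.injective⟩)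
    have hxB : x ∉ Finset.univ.map ⟨s, hs.injective⟩ := by
      simpa using fun i => (hsA i).1
    have hB : B.card = r + 1 := by
      rw [Finset.card_insert_of_notMem hxB, Finset.card_map, Finset.card_fin]
    let t := B.orderEmbOfFin hB
    have htr : Set.range t = B := Finset.range_orderEmbOfFin B hB
    obtain ⟨i, hi⟩ : x ∈ Set.range t := by rw [htr]; exact Finset.mem_insert_self _ _
    have hts : (fun k => t (i.succAbove k)) = s := by
      have hm : StrictMono fun k => t (i.succAbove k) :=
        t.strictMono.comp (Fin.strictMono_succAbove i)
      rw [← StrictMono.range_inj hm hs]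
      ext y
      have e1 : y ∈ Set.range t ↔ y = x ∨ ∃ k, s k = y := by
        rw [htr]; simp [B]
      constructor
      · rintro ⟨k, rfl⟩
        rcases e1.1 ⟨_, rfl⟩ with h | h
        · rw [← hi] at h
          exact absurd (t.injective h) (Fin.succAbove_ne i k)
        · exact h
      · rintro ⟨k, rfl⟩
        obtain ⟨j, hj⟩ := e1.2 (Or.inr ⟨k, rfl⟩)
        have hji : j ≠ i := by
          rintro rfl
          exact (hsA k).1 (hj.symm.trans hi)
        obtain ⟨l, rfl⟩ := Fin.exists_succAbove_eq hji
        exact ⟨l, hj⟩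
    refine ⟨(t, i), ?_, ?_⟩
    · simp only [Finset.mem_product, Finset.mem_filter, Finset.mem_univ, true_and, and_true]
      refine ⟨fun i j h => t.strictMono h, fun k => ?_⟩
      have : t k ∈ (B : Set (Fin n)) := htr ▸ ⟨k, rfl⟩
      rcases Finset.mem_insert.1 this with h | h
      · rw [h]; exact hx
      · obtain ⟨l, -, h⟩ := Finset.mem_map.1 h
        rw [← h]; exact (hsA l).2
    · exact Sigma.ext hi (heq_of_eq hts)
  · rintro ⟨s, i⟩ h
    simp only [Finset.mem_product, Finset.mem_filter, Finset.mem_univ, true_and, and_true] at h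
    have hs : StrictMono s := fun i j h' => h.1 i j h'
    have e1 : A.erase (s i) \ Finset.univ.image (fun k => s (i.succAbove k)) =
        A \ Finset.univ.image s := by
      ext y
      simp only [Finset.mem_sdiff, Finset.mem_erase, Finset.mem_image, Finset.mem_univ, true_and,
        Fin.exists_iff_succAbove i]
      tauto
    have e2 : ∀ k, ((A.erase (s i)).filter fun t => t < s (i.succAbove k) ∧
        ∀ j, t ≠ s (i.succAbove j)).card =
        (A.filter fun t => t < s (i.succAbove k) ∧ ∀ j, t ≠ s j).card := by
      intro k
      congr 1
      ext y
      simp only [Finset.mem_filter, Finset.mem_erase, Fin.forall_iff_succAbove i (P := fun j => y ≠ s j)]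
      tauto
    simp only [e1, e2]
    rw [card_filter_lt_eq_add hs h.2 i, Fin.sum_univ_succAbove _ i, Matrix.submatrix_submatrix]
    simp only [Matrix.submatrix_apply, pow_add, Function.comp_def]
    ring

theorem wedge_zero (C : Matrix (Fin n) (Fin n) R) (U : Matrix (Fin 3) (Fin n) R)
    (A : Finset (Fin n)) (a : Fin 0 → Fin 3) : wedge C U A a = pf C A := by
  simp [wedge]

end Wedge

section Extended

variable {R : Type u} [CommRing R] {n : ℕ}

/-- The alternating matrix on `n + 3` vertices which contains `C` and `U`. -/
def extMatrix (C : Matrix (Fin n) (Fin n) R) (U : Matrix (Fin 3) (Fin n) R) :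
    Matrix (Fin n ⊕ Fin 3) (Fin n ⊕ Fin 3) R :=
  Matrix.fromBlocks C (-U.transpose) U 0

variable {C : Matrix (Fin n) (Fin n) R} (U : Matrix (Fin 3) (Fin n) R)

theorem IsAlternating.extMatrix (hC : IsAlternating C) : IsAlternating (extMatrix C U) where
  diag := by rintro (i | i) <;> simp [AlmostCI.extMatrix, hC.diag]
  neg := by
    rintro (i | i) (j | j) <;> simp [AlmostCI.extMatrix]
    exact hC.neg i j

/-- The product of the basis vectors `e_i`, `i ∈ A`, in increasing order. -/
noncomputable def wedgeVec (R : Type u) [CommRing R] (A : Finset (Fin n)) :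
    ExteriorAlgebra R (Fin n ⊕ Fin 3 → R) :=
  ((A.sort (· ≤ ·)).map fun i => basisVec R (Sum.inl i)).prod

@[simp]
theorem wedgeVec_empty : wedgeVec R (∅ : Finset (Fin n)) = 1 := by
  simp [wedgeVec]

theorem wedgeVec_insert {A : Finset (Fin n)} {a : Fin n} (h : ∀ x ∈ A, a < x) :
    wedgeVec R (insert a A) = basisVec R (Sum.inl a) * wedgeVec R A := by
  rw [wedgeVec, Finset.sort_insert _ (fun b hb => (h b hb).le) (fun ha => lt_irrefl _ (h a ha)),
    List.map_cons, List.prod_cons, wedgeVec]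

@[simp]
theorem contract_inr_wedgeVec (g : Fin 3) (A : Finset (Fin n)) :
    contract (Sum.inr g) (wedgeVec R A) = 0 := by
  induction A using Finset.induction_on_min with
  | empty => simp
  | insert a A h ih => rw [wedgeVec_insert h, contract_basisVec_mul, ih]; simp

theorem contract_inl_wedgeVec (j : Fin n) (A : Finset (Fin n)) :
    contract (Sum.inl j) (wedgeVec R A) =
      if j ∈ A then (-1 : R) ^ (A.filter (· < j)).card • wedgeVec R (A.erase j) else 0 := by
  induction A using Finset.induction_on_min with
  | empty => simp
  | insert a A h ih =>
    have ha : a ∉ A := fun ha => lt_irrefl _ (h a ha)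
    rw [wedgeVec_insert h, contract_basisVec_mul, ih]
    by_cases hj : j = a
    · subst hj
      have : (insert j A).filter (· < j) = ∅ := by
        rw [Finset.filter_eq_empty_iff]
        intro x hx
        rcases Finset.mem_insert.1 hx with rfl | hx
        · exact lt_irrefl _
        · exact (h x hx).not_gt
      simp [ha, this]
    · by_cases hjA : j ∈ A
      · have h1 : (insert a A).filter (· < j) = insert a (A.filter (· < j)) := by
          rw [Finset.filter_insert, if_pos (h j hjA)]
        have h2 : (insert a A).erase j = insert a (A.erase j) :=
          Finset.erase_insert_of_ne (Ne.symm hj)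
        rw [h1, h2, wedgeVec_insert (fun x hx => h x (Finset.mem_of_mem_erase hx)),
          Finset.card_insert_of_notMem (fun hx => ha (Finset.mem_filter.1 hx).1)]
        simp [hj, hjA, pow_succ]
      · simp [hj, hjA]

theorem basisVec_inl_mul_wedgeVec {j : Fin n} {A : Finset (Fin n)} (hj : j ∈ A) :
    basisVec R (Sum.inl j) * wedgeVec R A = 0 := by
  induction A using Finset.induction_on_min with
  | empty => simp at hj
  | insert a A h ih =>
    rw [wedgeVec_insert h]
    rcases Finset.mem_insert.1 hj with rfl | hj
    · simp
    · rw [basisVec_mul_swap_mul, ih hj, mul_zero, neg_zero]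

theorem pfaffian_wedgeVec (hC : IsAlternating C) (A : Finset (Fin n)) :
    pfaffian (hC.extMatrix U) (wedgeVec R A) = pf C A := by
  rw [wedgeVec, pfaffian_prod_map]
  rfl

/-- The product of the basis vectors of the rows `a_1, …, a_r` of `U`. -/
noncomputable def rowProd (R : Type u) [CommRing R] (n : ℕ) {r : ℕ} (a : Fin r → Fin 3) :
    ExteriorAlgebra R (Fin n ⊕ Fin 3 → R) :=
  (List.ofFn fun i => basisVec R (Sum.inr (a i) : Fin n ⊕ Fin 3)).prod

theorem contract_inl_rowProd_mul {r : ℕ} (a : Fin r → Fin 3) (j : Fin n)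
    (x : ExteriorAlgebra R (Fin n ⊕ Fin 3 → R)) :
    contract (Sum.inl j) (rowProd R n a * x) =
      (-1 : R) ^ r • (rowProd R n a * contract (Sum.inl j) x) := by
  induction r with
  | zero => simp [rowProd]
  | succ r ih =>
    have := ih (fun i => a i.succ)
    simp only [rowProd, List.ofFn_succ, List.prod_cons, mul_assoc] at this ⊢
    rw [contract_basisVec_mul, this]
    simp [pow_succ]

theorem pfaffian_inr_mul (hC : IsAlternating C) (g : Fin 3)
    (x : ExteriorAlgebra R (Fin n ⊕ Fin 3 → R)) :
    pfaffian (hC.extMatrix U) (basisVec R (Sum.inr g) * x) =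
      ∑ j, U g j * pfaffian (hC.extMatrix U) (contract (Sum.inl j) x) := by
  rw [pfaffian_basisVec_mul]
  simp [Fintype.sum_sum_type, AlmostCI.extMatrix]

/-- The sign comes from expanding along the rows `a_1, …, a_r` one after the other: in front of `A`
the column removed at each step first has to pass the remaining rows. -/
theorem pfaffian_rowProd_mul_wedgeVec (hC : IsAlternating C) {r : ℕ} (a : Fin r → Fin 3)
    (A : Finset (Fin n)) :
    pfaffian (hC.extMatrix U) (rowProd R n a * wedgeVec R A) =
      (-1) ^ r.choose 2 * wedge C U A a := by
  induction r generalizing A with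
  | zero => simp [rowProd, wedge_zero, pfaffian_wedgeVec U hC]
  | succ r ih =>
    have h1 : rowProd R n a = basisVec R (Sum.inr (a 0)) * rowProd R n fun i => a i.succ := by
      simp [rowProd, List.ofFn_succ]
    rw [h1, mul_assoc, pfaffian_inr_mul U hC, wedge_succ, Finset.mul_sum,
      ← Finset.sum_subset (Finset.subset_univ A)]
    · refine Finset.sum_congr rfl fun j hj => ?_
      rw [contract_inl_rowProd_mul, contract_inl_wedgeVec, if_pos hj, mul_smul_comm, map_smul,
        map_smul, ih, Nat.choose_succ_succ' r 1, Nat.choose_one_right, pow_add]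
      simp only [smul_eq_mul]
      ring
    · intro j _ hj
      rw [contract_inl_rowProd_mul, contract_inl_wedgeVec, if_neg hj, mul_zero, smul_zero,
        map_zero, mul_zero]

end Extended

/-! ### The complex and its null-homotopies -/


section Complex

variable {R : Type u} [CommRing R] {n : ℕ} {C : Matrix (Fin n) (Fin n) R}
  (U : Matrix (Fin 3) (Fin n) R) (hC : IsAlternating C)

/-- The matrix whose row `r` consists of the Pfaffians of the contractions of `Ω r`. -/
noncomputable def contractMatrix {m : Type*} (Ω : m → ExteriorAlgebra R (Fin n ⊕ Fin 3 → R)) :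
    Matrix m (Fin n ⊕ Fin 3) R :=
  Matrix.of fun r l => pfaffian (hC.extMatrix U) (contract l (Ω r))

/-- Pairing the contractions of `x` with column `k` of `[C; U]` is expansion along row `k`. -/
theorem sum_fromRows_mul (k : Fin n) (x : ExteriorAlgebra R (Fin n ⊕ Fin 3 → R)) :
    ∑ l, pfaffian (hC.extMatrix U) (contract l x) * Matrix.fromRows C U l k =
      -pfaffian (hC.extMatrix U) (basisVec R (Sum.inl k) * x) := by
  rw [pfaffian_basisVec_mul, ← Finset.sum_neg_distrib]
  refine Finset.sum_congr rfl fun l _ => ?_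
  rw [(hC.extMatrix U).neg]
  rcases l with l | l <;> simp [extMatrix, mul_comm]

theorem contractMatrix_mul_fromRows {m : Type*}
    {Ω : m → ExteriorAlgebra R (Fin n ⊕ Fin 3 → R)}
    (hΩ : ∀ r i, basisVec R (Sum.inl i) * Ω r = 0) :
    contractMatrix U hC Ω * Matrix.fromRows C U = 0 := by
  ext r k
  refine (sum_fromRows_mul U hC k (Ω r)).trans ?_
  rw [hΩ, map_zero, neg_zero]
  rfl

/-- Multiplication by the Pfaffian of `τ` is null-homotopic as soon as the contractions of `τ` by the
rows of `U`, and its products with them, are combinations of the `Ω r`. The last component of the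
homotopy is formed by the double contractions of `τ`. -/
theorem nullHomotopic_of_rows {m : Type*} [Fintype m] [DecidableEq m]
    {Ω : m → ExteriorAlgebra R (Fin n ⊕ Fin 3 → R)} {d₁ : m → R}
    {τ : ExteriorAlgebra R (Fin n ⊕ Fin 3 → R)} (hτ : ∀ i, basisVec R (Sum.inl i) * τ = 0)
    (h₀ : m → R) (a b : Matrix (Fin 3) m R)
    (ha : ∀ g, ∑ r, a g r • Ω r = contract (Sum.inr g) τ)
    (hb : ∀ g, ∑ r, b g r • Ω r = basisVec R (Sum.inr g) * τ)
    (hd : d₁ ⬝ᵥ h₀ = pfaffian (hC.extMatrix U) τ)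
    (hone : ∀ i j, h₀ i * d₁ j +
      (∑ g, a g j * pfaffian (hC.extMatrix U) (basisVec R (Sum.inr g) * Ω i) +
        ∑ g, b g j * pfaffian (hC.extMatrix U) (contract (Sum.inr g) (Ω i))) =
          if i = j then pfaffian (hC.extMatrix U) τ else 0) :
    NullHomotopic d₁ (contractMatrix U hC Ω) (Matrix.fromRows C U)
      (pfaffian (hC.extMatrix U) τ) := by
  refine ⟨h₀, Matrix.fromRows (U.transpose * a) b, Matrix.of fun i l =>
    -pfaffian (hC.extMatrix U) (contract l (contract (Sum.inl i) τ)), hd, ?_, ?_, ?_⟩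
  · intro i j
    rw [← hone i j]
    congr 1
    simp only [Matrix.mul_apply, Fintype.sum_sum_type, Matrix.fromRows_apply_inl,
      Matrix.fromRows_apply_inr, contractMatrix, Matrix.of_apply, pfaffian_inr_mul U hC,
      Finset.mul_sum, Matrix.transpose_apply]
    rw [Finset.sum_comm]
    congr 1
    · refine Finset.sum_congr rfl fun g _ => Finset.sum_congr rfl fun j _ => by ring
    · refine Finset.sum_congr rfl fun g _ => by ring
  · ext v l
    have key : (Matrix.fromRows C U * Matrix.of fun i l =>
        -pfaffian (hC.extMatrix U) (contract l (contract (Sum.inl i) τ))) v l =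
        pfaffian (hC.extMatrix U) (basisVec R v * contract l τ) -
          ∑ g, extMatrix C U v (Sum.inr g) *
            pfaffian (hC.extMatrix U) (contract (Sum.inr g) (contract l τ)) := by
      rw [pfaffian_basisVec_mul, Fintype.sum_sum_type, add_sub_cancel_right, Matrix.mul_apply]
      refine Finset.sum_congr rfl fun i _ => ?_
      rw [Matrix.of_apply, contract_contract_comm, map_neg, neg_neg]
      rcases v with v | v <;> simp [extMatrix]
    have key2 : basisVec R v * contract l τ =
        (if l = v then τ else 0) - contract l (basisVec R v * τ) := by
      rw [contract_basisVec_mul, sub_sub_cancel]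
    have key3 : ∀ c : m → R, ∑ r, c r * pfaffian (hC.extMatrix U) (contract l (Ω r)) =
        pfaffian (hC.extMatrix U) (contract l (∑ r, c r • Ω r)) := fun c => by
      simp only [map_sum, map_smul, smul_eq_mul]
    have hx : pfaffian (hC.extMatrix U) (if l = v then τ else 0) =
        (pfaffian (hC.extMatrix U) τ • (1 : Matrix (Fin n ⊕ Fin 3) (Fin n ⊕ Fin 3) R)) v l := by
      rw [Matrix.smul_apply, Matrix.one_apply]
      by_cases h : l = v
      · simp [h]
      · simp [h, Ne.symm h]
    rw [Matrix.add_apply, key, key2, map_sub, hx]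
    rcases v with v | v
    · have h1 : (Matrix.fromRows (U.transpose * a) b * contractMatrix U hC Ω) (Sum.inl v) l =
          ∑ g, U g v * pfaffian (hC.extMatrix U) (contract l (contract (Sum.inr g) τ)) := by
        simp only [← ha, ← key3]
        simp only [Matrix.mul_apply, Matrix.fromRows_apply_inl, contractMatrix, Matrix.of_apply,
          Finset.mul_sum, Finset.sum_mul, Matrix.transpose_apply]
        rw [Finset.sum_comm]
        simp only [mul_assoc]
      rw [h1, hτ, map_zero, map_zero, sub_zero]
      have h2 : ∀ g, extMatrix C U (Sum.inl v) (Sum.inr g) *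
            pfaffian (hC.extMatrix U) (contract (Sum.inr g) (contract l τ)) =
          U g v * pfaffian (hC.extMatrix U) (contract l (contract (Sum.inr g) τ)) := fun g => by
        rw [contract_contract_comm, map_neg]
        simp [extMatrix]
      simp only [h2]
      ring
    · have h1 : (Matrix.fromRows (U.transpose * a) b * contractMatrix U hC Ω) (Sum.inr v) l =
          pfaffian (hC.extMatrix U) (contract l (basisVec R (Sum.inr v) * τ)) := by
        rw [← hb, ← key3]
        simp only [Matrix.mul_apply, Matrix.fromRows_apply_inr, contractMatrix, Matrix.of_apply]
      rw [h1]
      simp [extMatrix]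
  · ext i k
    simp only [Matrix.mul_apply, Matrix.of_apply, neg_mul, Finset.sum_neg_distrib]
    rw [sum_fromRows_mul U hC, neg_neg]
    have h1 := contract_basisVec_mul (Sum.inl i) (Sum.inl k) τ
    rw [hτ, map_zero, eq_comm, sub_eq_zero] at h1
    rw [← h1, Matrix.smul_apply, Matrix.one_apply]
    simp only [Sum.inl.injEq]
    split_ifs <;> simp

/-- The basis vector of row `g` of `U`. -/
noncomputable def rowVec (R : Type u) [CommRing R] {n : ℕ} (g : Fin 3) :
    ExteriorAlgebra R (Fin n ⊕ Fin 3 → R) :=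
  basisVec R (Sum.inr g)

/-- The product of the basis vectors of all columns. -/
noncomputable def topVec (R : Type u) [CommRing R] (n : ℕ) :
    ExteriorAlgebra R (Fin n ⊕ Fin 3 → R) :=
  wedgeVec R Finset.univ

@[simp]
theorem basisVec_inl_mul_topVec (i : Fin n) : basisVec R (Sum.inl i) * topVec R n = 0 :=
  basisVec_inl_mul_wedgeVec (Finset.mem_univ i)

@[simp]
theorem basisVec_inl_mul_rowVec_mul (i : Fin n) (g : Fin 3)
    (x : ExteriorAlgebra R (Fin n ⊕ Fin 3 → R)) :
    basisVec R (Sum.inl i) * (rowVec R g * x) = -(rowVec R g * (basisVec R (Sum.inl i) * x)) :=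
  basisVec_mul_swap_mul _ _ _

theorem rowVec_mul_swap_mul (g h : Fin 3) (x : ExteriorAlgebra R (Fin n ⊕ Fin 3 → R)) :
    rowVec R g * (rowVec R h * x) = -(rowVec R h * (rowVec R g * x)) :=
  basisVec_mul_swap_mul _ _ _

@[simp]
theorem rowVec_mul_self_mul (g : Fin 3) (x : ExteriorAlgebra R (Fin n ⊕ Fin 3 → R)) :
    rowVec R g * (rowVec R g * x) = 0 :=
  basisVec_mul_self_mul _ _

@[simp]
theorem contract_inr_topVec (g : Fin 3) : contract (Sum.inr g) (topVec R n) = 0 :=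
  contract_inr_wedgeVec _ _

@[simp]
theorem contract_inr_rowVec_mul (g h : Fin 3) (x : ExteriorAlgebra R (Fin n ⊕ Fin 3 → R)) :
    contract (Sum.inr g) (rowVec R h * x) =
      (if g = h then x else 0) - rowVec R h * contract (Sum.inr g) x := by
  rw [rowVec, contract_basisVec_mul]
  simp

/-- The elements whose contractions form the rows of the second differential for odd `n`. -/
noncomputable def oddRows (R : Type u) [CommRing R] (n : ℕ) :
    Fin 4 → ExteriorAlgebra R (Fin n ⊕ Fin 3 → R) :=
  ![topVec R n, rowVec R 1 * (rowVec R 2 * topVec R n), rowVec R 0 * (rowVec R 2 * topVec R n),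
    rowVec R 0 * (rowVec R 1 * topVec R n)]

/-- The elements whose contractions form the rows of the second differential for even `n`. -/
noncomputable def evenRows (R : Type u) [CommRing R] (n : ℕ) :
    Fin 4 → ExteriorAlgebra R (Fin n ⊕ Fin 3 → R) :=
  ![rowVec R 0 * (rowVec R 1 * (rowVec R 2 * topVec R n)), rowVec R 0 * topVec R n,
    rowVec R 1 * topVec R n, rowVec R 2 * topVec R n]

/-- The first differential for odd `n`. -/
noncomputable def oddGens : Fin 4 → R :=
  ![-pfaffian (hC.extMatrix U) (rowVec R 0 * (rowVec R 1 * (rowVec R 2 * topVec R n))),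
    pfaffian (hC.extMatrix U) (rowVec R 0 * topVec R n),
    -pfaffian (hC.extMatrix U) (rowVec R 1 * topVec R n),
    pfaffian (hC.extMatrix U) (rowVec R 2 * topVec R n)]

/-- The first differential for even `n`. -/
noncomputable def evenGens : Fin 4 → R :=
  ![pfaffian (hC.extMatrix U) (topVec R n),
    -pfaffian (hC.extMatrix U) (rowVec R 1 * (rowVec R 2 * topVec R n)),
    pfaffian (hC.extMatrix U) (rowVec R 0 * (rowVec R 2 * topVec R n)),
    -pfaffian (hC.extMatrix U) (rowVec R 0 * (rowVec R 1 * topVec R n))]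

theorem basisVec_inl_mul_oddRows (r : Fin 4) (i : Fin n) :
    basisVec R (Sum.inl i) * oddRows R n r = 0 := by
  fin_cases r <;> simp [oddRows]

theorem basisVec_inl_mul_evenRows (r : Fin 4) (i : Fin n) :
    basisVec R (Sum.inl i) * evenRows R n r = 0 := by
  fin_cases r <;> simp [evenRows]

theorem nullHomotopic_odd (g : Fin 3) :
    NullHomotopic (oddGens U hC) (contractMatrix U hC (oddRows R n)) (Matrix.fromRows C U)
      (pfaffian (hC.extMatrix U) (rowVec R g * topVec R n)) := by
  have s10 := rowVec_mul_swap_mul (R := R) (n := n) 1 0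
  have s20 := rowVec_mul_swap_mul (R := R) (n := n) 2 0
  have s21 := rowVec_mul_swap_mul (R := R) (n := n) 2 1
  have hr : ∀ g, basisVec R (Sum.inr g : Fin n ⊕ Fin 3) = rowVec R g := fun _ => rfl
  have h3 : ∀ P : Fin 3 → Prop, (∀ g, P g) ↔ P 0 ∧ P 1 ∧ P 2 := fun P => by
    simp [Fin.forall_fin_succ]
  have h4 : ∀ P : Fin 4 → Prop, (∀ g, P g) ↔ P 0 ∧ P 1 ∧ P 2 ∧ P 3 := fun P => by
    simp [Fin.forall_fin_succ]
  revert g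
  rw [h3]
  refine ⟨nullHomotopic_of_rows U hC (by simp) ![0, 1, 0, 0] !![1, 0, 0, 0; 0, 0, 0, 0; 0, 0, 0, 0]
    !![0, 0, 0, 0; 0, 0, 0, -1; 0, 0, -1, 0] ?_ ?_ ?_ ?_,
    nullHomotopic_of_rows U hC (by simp) ![0, 0, -1, 0] !![0, 0, 0, 0; 1, 0, 0, 0; 0, 0, 0, 0]
    !![0, 0, 0, 1; 0, 0, 0, 0; 0, -1, 0, 0] ?_ ?_ ?_ ?_,
    nullHomotopic_of_rows U hC (by simp) ![0, 0, 0, 1] !![0, 0, 0, 0; 0, 0, 0, 0; 1, 0, 0, 0]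
    !![0, 0, 1, 0; 0, 1, 0, 0; 0, 0, 0, 0] ?_ ?_ ?_ ?_⟩
  all_goals try simp only [h3, h4]
  all_goals simp [oddRows, oddGens, hr, Fin.sum_univ_four, Fin.sum_univ_three, s10, s20, s21]

theorem nullHomotopic_even :
    NullHomotopic (evenGens U hC) (contractMatrix U hC (evenRows R n)) (Matrix.fromRows C U)
      (pfaffian (hC.extMatrix U) (topVec R n)) ∧
    NullHomotopic (evenGens U hC) (contractMatrix U hC (evenRows R n)) (Matrix.fromRows C U)
      (pfaffian (hC.extMatrix U) (rowVec R 0 * (rowVec R 1 * topVec R n))) ∧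
    NullHomotopic (evenGens U hC) (contractMatrix U hC (evenRows R n)) (Matrix.fromRows C U)
      (pfaffian (hC.extMatrix U) (rowVec R 0 * (rowVec R 2 * topVec R n))) := by
  have s10 := rowVec_mul_swap_mul (R := R) (n := n) 1 0
  have s20 := rowVec_mul_swap_mul (R := R) (n := n) 2 0
  have s21 := rowVec_mul_swap_mul (R := R) (n := n) 2 1
  have hr : ∀ g, basisVec R (Sum.inr g : Fin n ⊕ Fin 3) = rowVec R g := fun _ => rfl
  have h3 : ∀ P : Fin 3 → Prop, (∀ g, P g) ↔ P 0 ∧ P 1 ∧ P 2 := fun P => by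
    simp [Fin.forall_fin_succ]
  have h4 : ∀ P : Fin 4 → Prop, (∀ g, P g) ↔ P 0 ∧ P 1 ∧ P 2 ∧ P 3 := fun P => by
    simp [Fin.forall_fin_succ]
  refine ⟨nullHomotopic_of_rows U hC (by simp) ![1, 0, 0, 0] 0
    !![0, 1, 0, 0; 0, 0, 1, 0; 0, 0, 0, 1] ?_ ?_ ?_ ?_,
    nullHomotopic_of_rows U hC (by simp) ![0, 0, 0, -1] !![0, 0, 1, 0; 0, -1, 0, 0; 0, 0, 0, 0]
    !![0, 0, 0, 0; 0, 0, 0, 0; 1, 0, 0, 0] ?_ ?_ ?_ ?_,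
    nullHomotopic_of_rows U hC (by simp) ![0, 0, 1, 0] !![0, 0, 0, 1; 0, 0, 0, 0; 0, -1, 0, 0]
    !![0, 0, 0, 0; -1, 0, 0, 0; 0, 0, 0, 0] ?_ ?_ ?_ ?_⟩
  all_goals try simp only [h3, h4]
  all_goals simp [evenRows, evenGens, hr, Fin.sum_univ_four, Fin.sum_univ_three, s10, s20, s21]

end Complex

/-! ### The matrices `oddTheta`, `evenTheta` and the generators in terms of the Pfaffian functional -/


section Generators

variable {R : Type u} [CommRing R] {n : ℕ} {C : Matrix (Fin n) (Fin n) R}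
  (U : Matrix (Fin 3) (Fin n) R) (hC : IsAlternating C)

theorem pfaffian_topVec : pfaffian (hC.extMatrix U) (topVec R n) = pf C Finset.univ :=
  pfaffian_wedgeVec U hC _

theorem pfaffian_one_row (a : Fin 3) :
    pfaffian (hC.extMatrix U) (rowVec R a * topVec R n) = wedge C U Finset.univ ![a] := by
  have := pfaffian_rowProd_mul_wedgeVec U hC ![a] Finset.univ
  simpa [rowProd, rowVec, topVec, List.ofFn_succ] using this

theorem pfaffian_two_rows (a b : Fin 3) :
    pfaffian (hC.extMatrix U) (rowVec R a * (rowVec R b * topVec R n)) =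
      -wedge C U Finset.univ ![a, b] := by
  have := pfaffian_rowProd_mul_wedgeVec U hC ![a, b] Finset.univ
  simpa [rowProd, rowVec, topVec, List.ofFn_succ, mul_assoc] using this

theorem pfaffian_three_rows (a b c : Fin 3) :
    pfaffian (hC.extMatrix U) (rowVec R a * (rowVec R b * (rowVec R c * topVec R n))) =
      -wedge C U Finset.univ ![a, b, c] := by
  have := pfaffian_rowProd_mul_wedgeVec U hC ![a, b, c] Finset.univ
  simpa [rowProd, rowVec, topVec, List.ofFn_succ, mul_assoc, show Nat.choose 3 2 = 3 from rfl, pow_succ] using this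

theorem pfaffian_contract_rowProd_mul_topVec {r : ℕ} (a : Fin r → Fin 3) (j : Fin n) :
    pfaffian (hC.extMatrix U) (contract (Sum.inl j) (rowProd R n a * topVec R n)) =
      (-1) ^ (r + r.choose 2) * ((-1) ^ (j : ℕ) * wedge C U (Finset.univ.erase j) a) := by
  rw [contract_inl_rowProd_mul, topVec, contract_inl_wedgeVec, if_pos (Finset.mem_univ j),
    mul_smul_comm, map_smul, map_smul, pfaffian_rowProd_mul_wedgeVec U hC]
  have : (Finset.univ.filter (· < j)).card = j := by
    rw [show Finset.univ.filter (· < j) = Finset.Iio j by ext; simp, Fin.card_Iio]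
  rw [this, pow_add, smul_eq_mul, smul_eq_mul]
  ring

theorem oddTheta_apply (r : Fin 4) (j : Fin n) :
    oddTheta C U r j = (![1, 1, -1, 1] : Fin 4 → R) r *
      contractMatrix U hC (oddRows R n) r (Sum.inl j) := by
  have h0 := pfaffian_contract_rowProd_mul_topVec U hC ![] j
  have h2 := fun a b => pfaffian_contract_rowProd_mul_topVec U hC ![a, b] j
  simp only [rowProd, List.ofFn_succ, List.ofFn_zero, List.prod_cons, List.prod_nil, one_mul,
    mul_one, wedge_zero, mul_assoc] at h0 h2
  have h12 := h2 1 2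
  have h02 := h2 0 2
  have h01 := h2 0 1
  simp at h0 h12 h02 h01
  change _ = _ * pfaffian (hC.extMatrix U) (contract (Sum.inl j) (oddRows R n r))
  fin_cases r <;> simp [oddTheta, oddRows, rowVec, h0, h12, h02, h01, pow_succ]

theorem evenTheta_apply (r : Fin 4) (j : Fin n) :
    evenTheta C U r j = (![1, -1, 1, -1] : Fin 4 → R) r *
      contractMatrix U hC (evenRows R n) r (Sum.inl j) := by
  have h3 := pfaffian_contract_rowProd_mul_topVec U hC ![0, 1, 2] j
  have h1 := fun a => pfaffian_contract_rowProd_mul_topVec U hC ![a] j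
  simp only [rowProd, List.ofFn_succ, List.ofFn_zero, List.prod_cons, List.prod_nil,
    mul_one, mul_assoc] at h3 h1
  simp [pow_succ] at h3 h1
  change _ = _ * pfaffian (hC.extMatrix U) (contract (Sum.inl j) (evenRows R n r))
  fin_cases r <;> simp [evenTheta, evenV, evenRows, rowVec, h3, h1]

theorem span_range_oddGens :
    Ideal.span (Set.range (oddGens U hC)) = Ideal.span (Set.range (oddX C U)) := by
  have h : oddGens U hC = ![wedge C U Finset.univ ![0, 1, 2], wedge C U Finset.univ ![0],
      -wedge C U Finset.univ ![1], wedge C U Finset.univ ![2]] := by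
    simp only [oddGens, pfaffian_one_row U hC, pfaffian_three_rows U hC, neg_neg]
  rw [h, oddX]
  simp [Ideal.span_insert, Ideal.span_singleton_neg]

theorem span_range_evenGens :
    Ideal.span (Set.range (evenGens U hC)) = Ideal.span (Set.range (evenX C U)) := by
  have h : evenGens U hC = ![pf C Finset.univ, wedge C U Finset.univ ![1, 2],
      -wedge C U Finset.univ ![0, 2], wedge C U Finset.univ ![0, 1]] := by
    simp only [evenGens, pfaffian_topVec U hC, pfaffian_two_rows U hC, neg_neg]
  rw [h, evenX]
  simp only [Matrix.range_cons, Matrix.range_empty, Set.union_empty, Ideal.span_union,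
    Ideal.span_singleton_neg]
  rw [sup_comm (Ideal.span {wedge C U Finset.univ ![1, 2]}),
    sup_comm (Ideal.span {wedge C U Finset.univ ![0, 2]}), sup_assoc]

/-- Modulo an ideal containing the products and contractions of `x` by the rows, the vector
of contractions of `x` is orthogonal to `C` and `U`. -/
theorem sum_fromRows_mul_contract_mem (J : Ideal R) {x : ExteriorAlgebra R (Fin n ⊕ Fin 3 → R)}
    (hx : ∀ i, basisVec R (Sum.inl i) * x = 0)
    (h₁ : ∀ g, pfaffian (hC.extMatrix U) (rowVec R g * x) ∈ J)
    (h₂ : ∀ g, pfaffian (hC.extMatrix U) (contract (Sum.inr g) x) ∈ J) (l : Fin n ⊕ Fin 3) :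
    ∑ j, Matrix.fromRows C U l j * pfaffian (hC.extMatrix U) (contract (Sum.inl j) x) ∈ J := by
  rcases l with k | g
  · have h := pfaffian_basisVec_mul (hC.extMatrix U) (Sum.inl k) x
    rw [hx, map_zero, Fintype.sum_sum_type, eq_comm, add_eq_zero_iff_eq_neg] at h
    simp only [extMatrix, Matrix.fromBlocks_apply₁₁] at h
    simp only [Matrix.fromRows_apply_inl]
    erw [h]
    exact J.neg_mem (J.sum_mem fun g _ => J.mul_mem_left _ (h₂ g))
  · simp only [Matrix.fromRows_apply_inr]
    rw [← pfaffian_inr_mul U hC]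
    exact h₁ g

theorem sum_fromRows_mul_oddRows_mem (r : Fin 4) (l : Fin n ⊕ Fin 3) :
    ∑ j, Matrix.fromRows C U l j * contractMatrix U hC (oddRows R n) r (Sum.inl j) ∈
      Ideal.span (Set.range (oddGens U hC)) := by
  have hm : ∀ i, oddGens U hC i ∈ Ideal.span (Set.range (oddGens U hC)) := fun i =>
    Ideal.subset_span ⟨i, rfl⟩
  have m0 := hm 0
  have m1 := hm 1
  have m2 := hm 2
  have m3 := hm 3
  simp only [oddGens, Matrix.cons_val, neg_mem_iff] at m0 m1 m2 m3
  have s10 := rowVec_mul_swap_mul (R := R) (n := n) 1 0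
  have s20 := rowVec_mul_swap_mul (R := R) (n := n) 2 0
  have s21 := rowVec_mul_swap_mul (R := R) (n := n) 2 1
  refine sum_fromRows_mul_contract_mem U hC _ (basisVec_inl_mul_oddRows r) ?_ ?_ l
  all_goals
    intro g
    fin_cases r <;> fin_cases g <;> simp [oddRows, s10, s20, s21] <;> assumption

theorem sum_fromRows_mul_evenRows_mem (r : Fin 4) (l : Fin n ⊕ Fin 3) :
    ∑ j, Matrix.fromRows C U l j * contractMatrix U hC (evenRows R n) r (Sum.inl j) ∈
      Ideal.span (Set.range (evenGens U hC)) := by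
  have hm : ∀ i, evenGens U hC i ∈ Ideal.span (Set.range (evenGens U hC)) := fun i =>
    Ideal.subset_span ⟨i, rfl⟩
  have m0 := hm 0
  have m1 := hm 1
  have m2 := hm 2
  have m3 := hm 3
  simp only [evenGens, Matrix.cons_val, neg_mem_iff] at m0 m1 m2 m3
  have s10 := rowVec_mul_swap_mul (R := R) (n := n) 1 0
  have s20 := rowVec_mul_swap_mul (R := R) (n := n) 2 0
  have s21 := rowVec_mul_swap_mul (R := R) (n := n) 2 1
  refine sum_fromRows_mul_contract_mem U hC _ (basisVec_inl_mul_evenRows r) ?_ ?_ l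
  all_goals
    intro g
    fin_cases r <;> fin_cases g <;> simp [evenRows, s10, s20, s21] <;> assumption

end Generators

/-! ### Lifting Koszul exactness from leading forms -/


section WeightFiltration

open MvPolynomial

variable {σ : Type*} {K : Type u} [Field K]

/-- The homomorphism `X_v ↦ X_v * t ^ W v`: the coefficient of `t ^ k` in the image of `f` is the
component of `f` of `W`-weight `k`. -/
noncomputable def weightHom (K : Type u) [Field K] (W : σ → ℕ) :
    MvPolynomial σ K →ₐ[K] Polynomial (MvPolynomial σ K) :=
  aeval fun v => Polynomial.C (X v) * Polynomial.X ^ W v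

theorem eval_one_weightHom (W : σ → ℕ) (a : MvPolynomial σ K) :
    (weightHom K W a).eval 1 = a := by
  have : ((Polynomial.aeval (1 : MvPolynomial σ K)).restrictScalars K).comp (weightHom K W) =
      AlgHom.id K _ := by
    ext v
    simp [weightHom]
  simpa [Polynomial.aeval_def, Polynomial.eval₂_eq_eval_map] using DFunLike.congr_fun this a

theorem weightHom_injective (W : σ → ℕ) : Function.Injective (weightHom K W) := fun a b h => by
  rw [← eval_one_weightHom W a, h, eval_one_weightHom]

theorem weightHom_monomial (W : σ → ℕ) (d : σ →₀ ℕ) (c : K) :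
    weightHom K W (monomial d c) =
      Polynomial.C (monomial d c) * Polynomial.X ^ (d.sum fun v e => W v * e) := by
  have h1 : (d.prod fun v e => (Polynomial.C (X v : MvPolynomial σ K)) ^ e) =
      Polynomial.C (d.prod fun v e => X v ^ e) := by
    simp only [Finsupp.prod, map_prod, map_pow]
  have h2 : (d.prod fun v e => (Polynomial.X ^ W v : Polynomial (MvPolynomial σ K)) ^ e) =
      Polynomial.X ^ (d.sum fun v e => W v * e) := by
    simp only [Finsupp.prod, Finsupp.sum, ← pow_mul, Finset.prod_pow_eq_pow_sum]
  rw [weightHom, aeval_monomial]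
  simp only [mul_pow]
  rw [Finsupp.prod_mul, h1, h2, ← mul_assoc, monomial_eq, map_mul]
  rfl

/-- Components are homogeneous. -/
theorem weightHom_coeff_weightHom (W : σ → ℕ) (a : MvPolynomial σ K) (k : ℕ) :
    weightHom K W ((weightHom K W a).coeff k) =
      Polynomial.C ((weightHom K W a).coeff k) * Polynomial.X ^ k := by
  induction a using MvPolynomial.induction_on' with
  | monomial d c =>
    rw [weightHom_monomial, Polynomial.coeff_C_mul_X_pow]
    split_ifs with h
    · rw [weightHom_monomial, h]
    · simp
  | add p q hp hq => rw [map_add, Polynomial.coeff_add, map_add, hp, hq, map_add, add_mul]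

theorem sum_sum_alternating_eq_zero {R ι : Type*} [CommRing R] [Fintype ι] {p : ι → ι → R}
    (h0 : ∀ i, p i i = 0) (h1 : ∀ i j, p i j = -p j i) (x : ι → R) :
    ∑ i, x i * ∑ j, p i j * x j = 0 := by
  classical
  simp only [Finset.mul_sum]
  rw [← Finset.sum_product']
  refine Finset.sum_involution (fun p _ => p.swap) (fun q _ => ?_) (fun q _ hp h => hp ?_)
    (fun q _ => by simp) (fun q _ => Prod.swap_swap q)
  · simp only [Prod.fst_swap, Prod.snd_swap]
    rw [h1 q.1 q.2]; ring
  · have : q.1 = q.2 := congrArg Prod.snd h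
    rw [this, h0]; ring

/-- Koszul relations lift from leading forms, by induction on a bound `D` for the weights of the
terms `x i * a i`: the components of weight `D` satisfy a relation among the leading forms, and
subtracting the Koszul relation with the same coefficients lowers `D`. -/
theorem KoszulExact.of_leading {ι : Type*} [Fintype ι] (W : σ → ℕ)
    {x l : ι → MvPolynomial σ K} (w : ι → ℕ)
    (hw : ∀ i k, w i < k → (weightHom K W (x i)).coeff k = 0)
    (hl : ∀ i, (weightHom K W (x i)).coeff (w i) = l i) (h : KoszulExact l) :
    KoszulExact x := by
  set Φ := weightHom K W
  have hx : ∀ i, (Φ (x i)).natDegree ≤ w i := fun i =>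
    Polynomial.natDegree_le_iff_coeff_eq_zero.2 (hw i)
  have hlh : ∀ i, Φ (l i) = Polynomial.C (l i) * Polynomial.X ^ w i := fun i => by
    rw [← hl]; exact weightHom_coeff_weightHom W _ _
  have main : ∀ D : ℕ, ∀ a : ι → MvPolynomial σ K,
      (∀ i k, D ≤ k + w i → (Φ (a i)).coeff k = 0) → ∑ i, x i * a i = 0 →
      ∃ p : ι → ι → MvPolynomial σ K, (∀ i, p i i = 0) ∧ (∀ i j, p i j = -p j i) ∧
        ∀ i, a i = ∑ j, p i j * x j := by
    intro D
    induction D with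
    | zero =>
      intro a ha _
      have ha0 : ∀ i, a i = 0 := fun i => weightHom_injective W <| by
        rw [map_zero]; ext1 k; exact ha i k (Nat.zero_le _)
      exact ⟨0, by simp, by simp, by simpa using ha0⟩
    | succ D ih =>
      intro a ha hsum
      have ha0 : ∀ i, D < w i → a i = 0 := fun i hi => weightHom_injective W <| by
        rw [map_zero]; ext1 k; exact ha i k (by omega)
      let α : ι → MvPolynomial σ K := fun i =>
        if w i ≤ D then (Φ (a i)).coeff (D - w i) else 0
      have hα : ∑ i, l i * α i = 0 := by
        have h1 := congrArg (fun z => (Φ z).coeff D) hsum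
        simp only [map_sum, map_mul, map_zero, Polynomial.finsetSum_coeff,
          Polynomial.coeff_zero] at h1
        rw [← h1]
        refine Finset.sum_congr rfl fun i _ => ?_
        by_cases hi : w i ≤ D
        · have h2 : (Φ (a i)).natDegree ≤ D - w i :=
            Polynomial.natDegree_le_iff_coeff_eq_zero.2 fun k hk => ha i k (by omega)
          have h3 := Polynomial.coeff_mul_add_eq_of_natDegree_le (hx i) h2
          rw [Nat.add_sub_cancel' hi] at h3
          rw [h3, hl]
          simp [α, hi]
        · simp [α, hi, ha0 i (by omega)]
      obtain ⟨q, hq0, hq1, hq⟩ := h α hα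
      let p : ι → ι → MvPolynomial σ K := fun i j =>
        if w i + w j ≤ D then (Φ (q i j)).coeff (D - (w i + w j)) else 0
      have hp0 : ∀ i, p i i = 0 := fun i => by simp [p, hq0]
      have hp1 : ∀ i j, p i j = -p j i := fun i j => by
        simp only [p, add_comm (w j)]
        rw [hq1 i j]
        split_ifs <;> simp
      have hpΦ : ∀ i j, w i + w j ≤ D →
          Φ (p i j) = Polynomial.C (p i j) * Polynomial.X ^ (D - (w i + w j)) := fun i j hij => by
        simp only [p, if_pos hij]
        exact weightHom_coeff_weightHom W _ _
      have hαp : ∀ i, α i = ∑ j, p i j * l j := by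
        intro i
        by_cases hi : w i ≤ D
        · have h1 : (Φ (α i)).coeff (D - w i) = α i := by
            simp only [α, if_pos hi]
            rw [weightHom_coeff_weightHom, Polynomial.coeff_C_mul_X_pow, if_pos rfl]
          rw [← h1, hq, map_sum, Polynomial.finsetSum_coeff]
          refine Finset.sum_congr rfl fun j _ => ?_
          rw [map_mul, hlh, mul_left_comm, Polynomial.coeff_C_mul, Polynomial.coeff_mul_X_pow',
            mul_comm]
          simp only [p, Nat.le_sub_iff_add_le' hi, Nat.sub_sub]
        · have h1 : ∀ j, p i j = 0 := fun j => if_neg (by omega)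
          simp [α, hi, h1]
      have hb : ∀ i k, D ≤ k + w i → (Φ (a i - ∑ j, p i j * x j)).coeff k = 0 := by
        intro i k hk
        rw [map_sub, map_sum, Polynomial.coeff_sub, Polynomial.finsetSum_coeff]
        by_cases hi : w i ≤ D
        · have hterm : ∀ j, (Φ (p i j * x j)).coeff k =
              if k = D - w i then p i j * l j else 0 := by
            intro j
            by_cases hij : w i + w j ≤ D
            · rw [map_mul, hpΦ i j hij, mul_assoc, Polynomial.coeff_C_mul,
                Polynomial.coeff_X_pow_mul', if_pos (by omega)]
              split_ifs with hkD
              · rw [← hl]; congr 2; omega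
              · rw [hw _ _ (by omega), mul_zero]
            · have : p i j = 0 := if_neg hij
              simp [this]
          simp only [hterm]
          by_cases hkD : k = D - w i
          · simp only [if_pos hkD]
            rw [← hαp, hkD]
            simp [α, hi]
          · simp only [if_neg hkD, Finset.sum_const_zero, sub_zero]
            exact ha i k (by omega)
        · have h1 : ∀ j, p i j = 0 := fun j => if_neg (by omega)
          simp [h1, ha0 i (by omega)]
      obtain ⟨r, hr0, hr1, hr⟩ := ih (fun i => a i - ∑ j, p i j * x j) hb (by
        simp only [mul_sub, Finset.sum_sub_distrib, hsum,
          sum_sum_alternating_eq_zero hp0 hp1, sub_zero])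
      refine ⟨fun i j => p i j + r i j, fun i => by simp [hp0, hr0], fun i j => ?_, fun i => ?_⟩
      · linear_combination hp1 i j + hr1 i j
      · simp only [add_mul, Finset.sum_add_distrib, ← hr i]
        ring
  intro a hsum
  refine main (∑ i, ((Φ (a i)).natDegree + 1 + w i)) a (fun i k hk => ?_) hsum
  apply Polynomial.coeff_eq_zero_of_natDegree_lt
  have := Finset.single_le_sum (f := fun i => (Φ (a i)).natDegree + 1 + w i)
    (fun _ _ => Nat.zero_le _) (Finset.mem_univ i)
  omega

theorem monomial_dvd_of_forall_le {d : σ →₀ ℕ} {c : K} (hc : c ≠ 0) {f : MvPolynomial σ K}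
    (h : ∀ m ∈ f.support, d ≤ m) : monomial d c ∣ f := by
  have h1 : monomial d (1 : K) ∣ f := by
    rw [monomial_one_dvd_iff_modMonomial_eq_zero]
    ext m
    by_cases hm : d ≤ m
    · rw [coeff_modMonomial_of_le _ hm, coeff_zero]
    · rw [coeff_modMonomial_of_not_le _ hm, coeff_zero]
      by_contra h'
      exact hm (h m (mem_support_iff.2 h'))
  have h2 : monomial d (1 : K) = monomial d c * C c⁻¹ := by
    rw [mul_comm, C_mul_monomial, inv_mul_cancel₀ hc]
  exact (Dvd.intro _ h2.symm).trans h1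

theorem le_of_mem_support_monomial_mul {d m : σ →₀ ℕ} {c : K} {f : MvPolynomial σ K}
    (h : m ∈ (monomial d c * f).support) : d ≤ m := by
  by_contra h'
  rw [mem_support_iff, coeff_monomial_mul', if_neg h'] at h
  exact h rfl

theorem le_of_le_add_of_disjoint {d e m : σ →₀ ℕ} (h : Disjoint d.support e.support)
    (hle : d ≤ m + e) : d ≤ m := by
  intro v
  by_cases hv : v ∈ d.support
  · have := hle v
    rwa [Finsupp.add_apply, Finsupp.notMem_support_iff.1 (Finset.disjoint_left.1 h hv),
      add_zero] at this
  · rw [Finsupp.notMem_support_iff.1 hv]; exact Nat.zero_le _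

theorem exists_eq_of_monomial_mul_add_eq_zero {d e : σ →₀ ℕ} {c c' : K} (hc : c ≠ 0)
    (hc' : c' ≠ 0) (hd : Disjoint d.support e.support) {a b : MvPolynomial σ K}
    (h : monomial d c * a + monomial e c' * b = 0) :
    ∃ p, a = p * monomial e c' ∧ b = -p * monomial d c := by
  have h1 : monomial e c' ∣ a := by
    refine monomial_dvd_of_forall_le hc' fun m hm => ?_
    refine le_of_le_add_of_disjoint (e := d) hd.symm ?_
    have h2 : m + d ∈ (monomial d c * a).support := by
      rw [mem_support_iff, add_comm, coeff_monomial_mul]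
      exact mul_ne_zero hc (mem_support_iff.1 hm)
    rw [eq_neg_of_add_eq_zero_left h, support_neg] at h2
    exact le_of_mem_support_monomial_mul h2
  obtain ⟨p, rfl⟩ := h1
  refine ⟨p, mul_comm _ _, ?_⟩
  have h3 : monomial e c' ≠ 0 := by simpa [monomial_eq_zero] using hc'
  apply mul_left_cancel₀ h3
  linear_combination h

theorem koszulExact_two_monomials {d : Fin 2 → σ →₀ ℕ} {c : Fin 2 → K} (hc : ∀ i, c i ≠ 0)
    (hd : Disjoint (d 0).support (d 1).support) :
    KoszulExact fun i => monomial (d i) (c i) := by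
  intro a ha
  rw [Fin.sum_univ_two] at ha
  obtain ⟨p, h0, h1⟩ := exists_eq_of_monomial_mul_add_eq_zero (hc 0) (hc 1) hd ha
  refine ⟨![![0, p], ![-p, 0]], ?_, ?_, ?_⟩
  · intro i; fin_cases i <;> rfl
  · intro i j; fin_cases i <;> fin_cases j <;> simp
  · intro i; fin_cases i <;> simp [h0, h1]

theorem koszulExact_three_monomials {d : Fin 3 → σ →₀ ℕ} {c : Fin 3 → K} (hc : ∀ i, c i ≠ 0)
    (hd : ∀ i j, i ≠ j → Disjoint (d i).support (d j).support) :
    KoszulExact fun i => monomial (d i) (c i) := by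
  intro a ha
  rw [Fin.sum_univ_three] at ha
  classical
  -- every monomial of `a 2` is divisible by one of the first two monomials
  obtain ⟨q, r, hqr⟩ : ∃ q r, a 2 = q * monomial (d 0) (c 0) + r * monomial (d 1) (c 1) := by
    have h1 : monomial (d 1) (c 1) ∣ (a 2).modMonomial (d 0) := by
      refine monomial_dvd_of_forall_le (hc 1) fun m hm => ?_
      rw [mem_support_iff] at hm
      have h0 : ¬ d 0 ≤ m := fun h => hm (coeff_modMonomial_of_le _ h)
      rw [coeff_modMonomial_of_not_le _ h0] at hm
      have h2 : m + d 2 ∈ (monomial (d 2) (c 2) * a 2).support := by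
        rw [mem_support_iff, add_comm, coeff_monomial_mul]
        exact mul_ne_zero (hc 2) hm
      rw [eq_neg_of_add_eq_zero_right ha, support_neg] at h2
      rcases Finset.mem_union.1 (support_add h2) with h2 | h2
      · exact absurd (le_of_le_add_of_disjoint (hd 0 2 (by decide))
          (le_of_mem_support_monomial_mul h2)) h0
      · exact le_of_le_add_of_disjoint (hd 1 2 (by decide)) (le_of_mem_support_monomial_mul h2)
    obtain ⟨r, hr⟩ := h1
    refine ⟨C (c 0)⁻¹ * (a 2).divMonomial (d 0), r, ?_⟩
    have h3 : C (c 0)⁻¹ * monomial (d 0) (c 0) = monomial (d 0) (1 : K) := by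
      rw [C_mul_monomial, inv_mul_cancel₀ (hc 0)]
    have h4 := divMonomial_add_modMonomial (a 2) (d 0)
    rw [← h3, hr] at h4
    linear_combination -h4
  have h5 : monomial (d 0) (c 0) * (a 0 + monomial (d 2) (c 2) * q) +
      monomial (d 1) (c 1) * (a 1 + monomial (d 2) (c 2) * r) = 0 := by
    rw [hqr] at ha
    linear_combination ha
  obtain ⟨p, h0, h1⟩ := exists_eq_of_monomial_mul_add_eq_zero (hc 0) (hc 1)
    (hd 0 1 (by decide)) h5
  refine ⟨![![0, p, -q], ![-p, 0, -r], ![q, r, 0]], ?_, ?_, ?_⟩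
  · intro i; fin_cases i <;> rfl
  · intro i j; fin_cases i <;> fin_cases j <;> simp
  · intro i
    fin_cases i
    · simp [Fin.sum_univ_three]; linear_combination h0
    · simp [Fin.sum_univ_three]; linear_combination h1
    · simp [Fin.sum_univ_three, hqr]

end WeightFiltration

/-! ### Leading forms of Pfaffians -/


section PfaffianLeadingForm

open MvPolynomial

theorem cons_eraseIdx_perm {V : Type*} (l : List V) (k : Fin l.length) :
    (l.get k :: l.eraseIdx k).Perm l := by
  simpa using List.getElem_cons_eraseIdx_perm k.2

/-- If the degrees of the entries of `T` are bounded by sums of vertex potentials, then the degree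
of a Pfaffian is bounded by the total potential, and its coefficient in that degree is the Pfaffian
of the matrix of extremal coefficients. -/
theorem coeff_pfList_of_le {R S : Type*} [CommRing R] [CommRing S] {V : Type*}
    (Φ : R →+* Polynomial S) (T : Matrix V V R) (g : V → ℕ)
    (hT : ∀ i j k, g i + g j < k → (Φ (T i j)).coeff k = 0) (l : List V) :
    (∀ k, (l.map g).sum < k → (Φ (pfList T l)).coeff k = 0) ∧
      (Φ (pfList T l)).coeff (l.map g).sum =
        pfList (Matrix.of fun i j => (Φ (T i j)).coeff (g i + g j)) l := by
  induction hl : l.length using Nat.strong_induction_on generalizing l with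
  | _ N ih =>
    subst hl
    cases l with
    | nil =>
      simp only [pfList, List.map_nil, List.sum_nil, map_one]
      exact ⟨fun k hk => by rw [Polynomial.coeff_one, if_neg hk.ne'], by simp⟩
    | cons i l =>
      have hsum : ∀ k : Fin l.length, ((i :: l).map g).sum =
          (g i + g (l.get k)) + ((l.eraseIdx k).map g).sum := fun k => by
        have := ((cons_eraseIdx_perm l k).map g).sum_eq
        simp only [List.map_cons, List.sum_cons] at this ⊢
        omega
      have ih' : ∀ k : Fin l.length, _ := fun k => ih (l.eraseIdx k).length (by
        have := List.length_eraseIdx_le l (k : ℕ)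
        simp only [List.length_cons]; omega) (l.eraseIdx k) rfl
      have hneg : ∀ k : ℕ, Φ ((-1) ^ k) = Polynomial.C ((-1) ^ k) := fun k => by simp
      have hdeg : ∀ i j, (Φ (T i j)).natDegree ≤ g i + g j := fun i j =>
        Polynomial.natDegree_le_iff_coeff_eq_zero.2 (hT i j)
      have hdeg' : ∀ k : Fin l.length, (Φ (pfList T (l.eraseIdx k))).natDegree ≤
          ((l.eraseIdx k).map g).sum := fun k =>
        Polynomial.natDegree_le_iff_coeff_eq_zero.2 (ih' k).1
      rw [pfList, pfList]
      simp only [map_sum, map_mul, hneg, Polynomial.finsetSum_coeff, mul_assoc,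
        Polynomial.coeff_C_mul]
      refine ⟨fun k hk => Finset.sum_eq_zero fun j _ => ?_, Finset.sum_congr rfl fun j _ => ?_⟩
      · rw [hsum j] at hk
        rw [Polynomial.coeff_eq_zero_of_natDegree_lt, mul_zero]
        exact (Polynomial.natDegree_mul_le_of_le (hdeg _ _) (hdeg' j)).trans_lt hk
      · rw [hsum j, Polynomial.coeff_mul_add_eq_of_natDegree_le (hdeg _ _) (hdeg' j), (ih' j).2]
        rfl

/-- The Pfaffian of a matrix supported on a perfect matching `μ`. -/
theorem exists_pfList_eq_monomial {σ : Type*} {K : Type u} [Field K] {V : Type*}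
    (T : Matrix V V (MvPolynomial σ K)) (P : Set σ) (μ : V → V) (l : List V) (hl : l.Nodup)
    (hμ : ∀ i ∈ l, μ i ∈ l ∧ μ i ≠ i ∧ μ (μ i) = i)
    (hP : ∀ i ∈ l, ∃ v ∈ P, ∃ c : K, c ≠ 0 ∧ T i (μ i) = monomial (Finsupp.single v 1) c)
    (h0 : ∀ i ∈ l, ∀ j ∈ l, j ≠ μ i → T i j = 0) :
    ∃ (d : σ →₀ ℕ) (c : K), c ≠ 0 ∧ (∀ v ∈ d.support, v ∈ P) ∧ pfList T l = monomial d c := by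
  classical
  induction hN : l.length using Nat.strong_induction_on generalizing l with
  | _ N ih =>
    subst hN
    cases l with
    | nil => exact ⟨0, 1, one_ne_zero, by simp, by rw [pfList]; rfl⟩
    | cons i l =>
      obtain ⟨h1, h2, h3⟩ := hμ i List.mem_cons_self
      have h4 : μ i ∈ l := (List.mem_cons.1 h1).resolve_left h2
      obtain ⟨k, hk⟩ := List.get_of_mem h4
      have hperm := (cons_eraseIdx_perm l k).cons i
      have hnd := hperm.nodup_iff.2 hl
      rw [hk] at hperm hnd
      simp only [List.nodup_cons, List.mem_cons, not_or] at hnd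
      obtain ⟨⟨-, hi⟩, hki, hnd⟩ := hnd
      have hsub : ∀ x ∈ l.eraseIdx k, x ∈ i :: l := fun x hx =>
        hperm.subset (List.mem_cons_of_mem _ (List.mem_cons_of_mem _ hx))
      obtain ⟨d, c, hc, hd, hdc⟩ := ih (l.eraseIdx k).length (by
        have := List.length_eraseIdx_le l (k : ℕ)
        simp only [List.length_cons]; omega) (l.eraseIdx k) hnd (fun x hx => by
          obtain ⟨h5, h6, h7⟩ := hμ x (hsub x hx)
          refine ⟨?_, h6, h7⟩
          rcases List.mem_cons.1 (hperm.symm.subset h5) with h | h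
          · exact absurd (show x = μ i by rw [← h7, h]) (fun h => hki (h ▸ hx))
          · rcases List.mem_cons.1 h with h | h
            · exact absurd (show x = i by rw [← h7, h, h3]) (fun h => hi (h ▸ hx))
            · exact h) (fun x hx => hP x (hsub x hx))
          (fun x hx y hy => h0 x (hsub x hx) y (hsub y hy)) rfl
      obtain ⟨v, hv, e, he, hT⟩ := hP i List.mem_cons_self
      refine ⟨Finsupp.single v 1 + d, (-1) ^ (k : ℕ) * e * c,
        mul_ne_zero (mul_ne_zero (pow_ne_zero _ (neg_ne_zero.2 one_ne_zero)) he) hc, ?_, ?_⟩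
      · intro w hw
        rcases Finset.mem_union.1 (Finsupp.support_add hw) with h | h
        · rw [Finset.mem_singleton.1 (Finsupp.support_single_subset h)]; exact hv
        · exact hd w h
      · rw [pfList, Finset.sum_eq_single k]
        · rw [hk, hT, hdc, show ((-1 : MvPolynomial σ K) ^ (k : ℕ)) = C ((-1) ^ (k : ℕ)) by simp,
            C_mul_monomial, monomial_mul]
        · intro j _ hj
          have hne : l.get j ≠ μ i := fun h => hj <|
            (List.nodup_iff_injective_get.1 (List.nodup_cons.1 hl).2) (h.trans hk.symm)
          rw [h0 i List.mem_cons_self _ (List.mem_cons_of_mem _ (List.get_mem _ _)) hne]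
          ring
        · intro h; exact absurd (Finset.mem_univ k) h

/-- `f` has a single monomial of top `W`-weight, whose variables lie in `P`. -/
def HasLeadingMonomial {σ : Type*} {K : Type u} [Field K] (W : σ → ℕ) (P : Set σ)
    (f : MvPolynomial σ K) : Prop :=
  ∃ (w : ℕ) (d : σ →₀ ℕ) (c : K), c ≠ 0 ∧ (∀ v ∈ d.support, v ∈ P) ∧
    (∀ k, w < k → (weightHom K W f).coeff k = 0) ∧ (weightHom K W f).coeff w = monomial d c

theorem HasLeadingMonomial.koszulExact {σ : Type*} {K : Type u} [Field K] {W : σ → ℕ}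
    {P : Fin 3 → Set σ} {x : Fin 3 → MvPolynomial σ K} (h : ∀ i, HasLeadingMonomial W (P i) (x i))
    (hP : ∀ i j, i ≠ j → Disjoint (P i) (P j)) :
    x 0 ≠ 0 ∧ KoszulExact ![x 0, x 1] ∧ KoszulExact ![x 0, x 1, x 2] := by
  choose w d c hc hd hw hl using h
  have hdis : ∀ i j, i ≠ j → Disjoint (d i).support (d j).support := fun i j hij => by
    rw [Finset.disjoint_left]
    exact fun v hi hj => Set.disjoint_left.1 (hP i j hij) (hd i v hi) (hd j v hj)
  refine ⟨fun h => ?_, ?_, ?_⟩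
  · have := hl 0
    rw [h, map_zero, Polynomial.coeff_zero, eq_comm, monomial_eq_zero] at this
    exact hc 0 this
  · have := KoszulExact.of_leading W (x := fun i : Fin 2 => x i.castSucc)
      (fun i => w i.castSucc) (fun i => hw _) (fun i => hl _)
      (koszulExact_two_monomials (fun i => hc _) (hdis 0 1 (by decide)))
    convert this using 1
    ext i; fin_cases i <;> rfl
  · have := KoszulExact.of_leading W w hw hl (koszulExact_three_monomials hc hdis)
    convert this using 1
    ext i; fin_cases i <;> rfl

/-- If every entry of `T` is zero or, up to sign, a variable, with weights `ω` bounded by a sum of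
vertex potentials `g`, and if within `l` the bound is attained exactly on the pairs of a perfect
matching `μ`, then the leading form of the Pfaffian is, up to a unit, the product of the entries
of the matching. -/
theorem hasLeadingMonomial_pfList {σ : Type*} {K : Type u} [Field K] {V : Type*} (W : σ → ℕ)
    (P : Set σ) (T : Matrix V V (MvPolynomial σ K)) (ω : V → V → ℕ) (g : V → ℕ)
    (hT : ∀ i j, T i j = 0 ∨ ∃ v, (T i j = X v ∨ T i j = -X v) ∧ W v = ω i j)
    (hω : ∀ i j, ω i j ≤ g i + g j) (μ : V → V) (l : List V) (hl : l.Nodup)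
    (hμ : ∀ i ∈ l, μ i ∈ l ∧ μ i ≠ i ∧ μ (μ i) = i)
    (hP : ∀ i ∈ l, ω i (μ i) = g i + g (μ i) ∧ ∃ v ∈ P, T i (μ i) = X v ∨ T i (μ i) = -X v)
    (h0 : ∀ i ∈ l, ∀ j ∈ l, j ≠ μ i → T i j = 0 ∨ ω i j < g i + g j) :
    HasLeadingMonomial W P (pfList T l) := by
  have hΦ : ∀ v, weightHom K W (X v) = Polynomial.C (X v) * Polynomial.X ^ W v := fun v => by
    simp [weightHom]
  have hcoeff : ∀ i j k, (weightHom K W (T i j)).coeff k =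
      if k = ω i j then T i j else 0 := by
    intro i j k
    rcases hT i j with h | ⟨v, h | h, hv⟩
    · simp [h]
    · rw [h, hΦ, hv, Polynomial.coeff_C_mul_X_pow]
    · rw [h, map_neg, hΦ, hv, Polynomial.coeff_neg, Polynomial.coeff_C_mul_X_pow]
      split_ifs <;> simp
  obtain ⟨h1, h2⟩ := coeff_pfList_of_le (weightHom K W : _ →+* _) T g (fun i j k hk => by
    have := hω i j
    exact (hcoeff i j k).trans (if_neg (by omega))) l
  obtain ⟨d, c, hc, hd, h3⟩ := exists_pfList_eq_monomial
    (Matrix.of fun i j => (weightHom K W (T i j)).coeff (g i + g j)) P μ l hl hμ (fun i hi => by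
      obtain ⟨h4, v, hv, h5⟩ := hP i hi
      rw [Matrix.of_apply, hcoeff, if_pos h4.symm]
      rcases h5 with h5 | h5
      · exact ⟨v, hv, 1, one_ne_zero, h5⟩
      · exact ⟨v, hv, -1, neg_ne_zero.2 one_ne_zero, by rw [h5, map_neg]; rfl⟩)
    (fun i hi j hj hij => by
      rw [Matrix.of_apply, hcoeff]
      rcases h0 i hi j hj hij with h | h
      · rw [h, ite_self]
      · exact if_neg h.ne')
  exact ⟨_, d, c, hc, hd, h1, h2.trans h3⟩

end PfaffianLeadingForm

/-! ### Weights on the generic matrices -/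


section Generic

open MvPolynomial

variable {n : ℕ}

/-- The weight `2n² - 2(s - (n - 1))²` of the entries `c_{ij}` with `i + j = s`, strictly concave in
`s`. It is nonnegative for `i, j < n`, so the truncation is harmless. -/
def entryWeight (n s : ℕ) : ℕ := (2 * (n : ℤ) ^ 2 - 2 * ((s : ℤ) - (n - 1)) ^ 2).toNat

/-- The weights of the entries of the extended matrix: the variables `u_{gj}` with `(g, j) ∈ H`
get a large weight, the other `u_{gj}` weight zero. -/
def edgeWeight (H : Finset (Fin 3 × Fin n)) : Fin n ⊕ Fin 3 → Fin n ⊕ Fin 3 → ℕ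
  | Sum.inl i, Sum.inl j => entryWeight n (i + j)
  | Sum.inl i, Sum.inr g => if (g, i) ∈ H then 4 * n ^ 2 + 4 else 0
  | Sum.inr g, Sum.inl j => if (g, j) ∈ H then 4 * n ^ 2 + 4 else 0
  | Sum.inr _, Sum.inr _ => 0

/-- The weights of the variables, compatible with `edgeWeight`. -/
def varWeight (H : Finset (Fin 3 × Fin n)) : Vars n → ℕ
  | Sum.inl p => entryWeight n (p.1.1 + p.1.2)
  | Sum.inr p => if p ∈ H then 4 * n ^ 2 + 4 else 0

/-- Half the tangent line of the concave function `entryWeight` at `s = n - 1 + δ`, as an additive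
function of the vertices. -/
def potential (n : ℕ) (δ : ℤ) (i : ℕ) : ℕ :=
  ((n : ℤ) ^ 2 + δ ^ 2 - 2 * δ * (2 * i - (n - 1))).toNat

/-- The potentials of all vertices. A row `g ∈ a` is given the value which makes its entry in
column `r g` tight. -/
def vertexPotential (δ : ℤ) (a : List (Fin 3)) (r : Fin 3 → Fin n) : Fin n ⊕ Fin 3 → ℕ
  | Sum.inl i => potential n δ i
  | Sum.inr g => if g ∈ a then 4 * n ^ 2 + 4 - potential n δ (r g) else 4 * n ^ 2 + 4

/-- The variables occurring in the leading monomial: `c_{ij}` with `i + j = n - 1 + δ`, and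
`u_{g, r g}` for `g ∈ a`. -/
def tightVars (δ : ℤ) (a : List (Fin 3)) (r : Fin 3 → Fin n) : Set (Vars n)
  | Sum.inl p => ((p.1.1 : ℕ) : ℤ) + (p.1.2 : ℕ) = n - 1 + δ
  | Sum.inr p => p.1 ∈ a ∧ r p.1 = p.2

theorem potential_eq {δ : ℤ} (hδ : δ = -1 ∨ δ = 0 ∨ δ = 1) {i : ℕ} (hi : i < n) :
    (potential n δ i : ℤ) = (n : ℤ) ^ 2 + δ ^ 2 - 2 * δ * (2 * i - (n - 1)) := by
  rw [potential, Int.toNat_of_nonneg]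
  have hi' : (i : ℤ) < n := by exact_mod_cast hi
  have hi0 : (0 : ℤ) ≤ i := by positivity
  rcases hδ with rfl | rfl | rfl <;> nlinarith [sq_nonneg ((n : ℤ) - 1)]

theorem potential_lt {δ : ℤ} (hδ : δ = -1 ∨ δ = 0 ∨ δ = 1) {i : ℕ} (hi : i < n) :
    potential n δ i < 4 * n ^ 2 + 4 := by
  have h := potential_eq hδ hi
  have hi' : (i : ℤ) < n := by exact_mod_cast hi
  have hi0 : (0 : ℤ) ≤ i := by positivity
  zify
  rw [h]
  rcases hδ with rfl | rfl | rfl <;> nlinarith [sq_nonneg ((n : ℤ) - 1)]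

theorem entryWeight_eq {i j : ℕ} (hi : i < n) (hj : j < n) :
    (entryWeight n (i + j) : ℤ) = 2 * (n : ℤ) ^ 2 - 2 * ((i : ℤ) + j - (n - 1)) ^ 2 := by
  rw [entryWeight, Int.toNat_of_nonneg, Nat.cast_add]
  have : ((i : ℤ) + j - (n - 1)) ^ 2 ≤ (n : ℤ) ^ 2 := by
    apply sq_le_sq'
    · have : (0 : ℤ) ≤ i + j := by positivity
      omega
    · omega
  push_cast
  linarith

/-- The potentials bound the weight, with equality exactly for `i + j = n - 1 + δ`. -/
theorem potential_add_potential {δ : ℤ} (hδ : δ = -1 ∨ δ = 0 ∨ δ = 1) {i j : ℕ} (hi : i < n)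
    (hj : j < n) : ((potential n δ i + potential n δ j : ℕ) : ℤ) =
      entryWeight n (i + j) + 2 * ((i : ℤ) + j - (n - 1) - δ) ^ 2 := by
  rw [Nat.cast_add, potential_eq hδ hi, potential_eq hδ hj, entryWeight_eq hi hj]
  ring

theorem genC_isAlternating (K : Type u) [Field K] (n : ℕ) : IsAlternating (genC K n) where
  diag i := by simp [genC]
  neg i j := by
    rcases lt_trichotomy i j with h | rfl | h
    · simp [genC, h, h.not_gt]
    · simp [genC]
    · simp [genC, h, h.not_gt]

theorem genC_eq_var (K : Type u) [Field K] {i j : Fin n} (h : i ≠ j) :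
    ∃ p : {p : Fin n × Fin n // p.1 < p.2}, (p.1.1 : ℕ) + (p.1.2 : ℕ) = i + j ∧
      (genC K n i j = X (Sum.inl p) ∨ genC K n i j = -X (Sum.inl p)) := by
  rcases lt_or_gt_of_ne h with h | h
  · exact ⟨⟨(i, j), h⟩, rfl, Or.inl (by simp [genC, h])⟩
  · exact ⟨⟨(j, i), h⟩, Nat.add_comm _ _, Or.inr (by simp [genC, h, h.not_gt])⟩

theorem extMatrix_eq_var (K : Type u) [Field K] (H : Finset (Fin 3 × Fin n))
    (i j : Fin n ⊕ Fin 3) : extMatrix (genC K n) (genU K n) i j = 0 ∨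
      ∃ v, (extMatrix (genC K n) (genU K n) i j = X v ∨
        extMatrix (genC K n) (genU K n) i j = -X v) ∧ varWeight H v = edgeWeight H i j := by
  rcases i with i | g <;> rcases j with j | g'
  · by_cases h : i = j
    · left; simp [extMatrix, h, genC]
    · obtain ⟨p, hp, hp'⟩ := genC_eq_var K h
      exact Or.inr ⟨Sum.inl p, by simpa [extMatrix] using hp', by simp [varWeight, edgeWeight, hp]⟩
  · exact Or.inr ⟨Sum.inr (g', i), Or.inr (by simp [extMatrix, genU]), rfl⟩
  · exact Or.inr ⟨Sum.inr (g, j), Or.inl (by simp [extMatrix, genU]), rfl⟩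
  · left; simp [extMatrix]

/-- The rows in `a`, followed by all columns. -/
noncomputable def vertexList (n : ℕ) (a : List (Fin 3)) : List (Fin n ⊕ Fin 3) :=
  a.map Sum.inr ++ ((Finset.univ : Finset (Fin n)).sort (· ≤ ·)).map Sum.inl

theorem inl_mem_vertexList (a : List (Fin 3)) (i : Fin n) : Sum.inl i ∈ vertexList n a := by
  simp [vertexList]

theorem inr_mem_vertexList {a : List (Fin 3)} {g : Fin 3} :
    (Sum.inr g : Fin n ⊕ Fin 3) ∈ vertexList n a ↔ g ∈ a := by
  simp [vertexList]

theorem vertexList_nodup {a : List (Fin 3)} (ha : a.Nodup) : (vertexList n a).Nodup := by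
  rw [vertexList, List.nodup_append]
  refine ⟨ha.map Sum.inr_injective, (Finset.sort_nodup _ _).map Sum.inl_injective, ?_⟩
  simp

/-- The leading monomial of the Pfaffian on the rows `a` and all columns: row `g` is matched with
column `r g`, and the remaining columns by the reflection `i ↦ n - 1 + δ - i`. -/
theorem hasLeadingMonomial_of_reflection (K : Type u) [Field K] {δ : ℤ}
    (hδ : δ = -1 ∨ δ = 0 ∨ δ = 1) (H : Finset (Fin 3 × Fin n)) {a : List (Fin 3)} (ha : a.Nodup)
    (r : Fin 3 → Fin n) (hr : ∀ g ∈ a, ∀ g' ∈ a, r g = r g' → g = g')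
    (hH : ∀ g ∈ a, (g, r g) ∈ H)
    (hH' : ∀ g ∈ a, ∀ j, (g, j) ∈ H → j ≠ r g → δ * (j : ℕ) < δ * (r g : ℕ))
    (hpair : ∀ g ∈ a, ∀ g' ∈ a, g ≠ g' → ((r g : ℕ) : ℤ) + (r g' : ℕ) ≠ n - 1 + δ)
    (hrefl : ∀ i : Fin n, (∀ g ∈ a, r g ≠ i) → 0 ≤ (n : ℤ) - 1 + δ - (i : ℕ) ∧
      (n : ℤ) - 1 + δ - (i : ℕ) < n ∧ (n : ℤ) - 1 + δ - (i : ℕ) ≠ (i : ℕ) ∧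
      ∀ g ∈ a, ((r g : ℕ) : ℤ) ≠ (n : ℤ) - 1 + δ - (i : ℕ)) :
    HasLeadingMonomial (varWeight H) (tightVars δ a r)
      (pfList (extMatrix (genC K n) (genU K n)) (vertexList n a)) := by
  classical
  let κ : Fin n → Fin n := fun i => ⟨((n : ℤ) - 1 + δ - (i : ℕ)).toNat % n,
    Nat.mod_lt _ i.pos⟩
  have hκ : ∀ i : Fin n, (∀ g ∈ a, r g ≠ i) → ((κ i : ℕ) : ℤ) = (n : ℤ) - 1 + δ - (i : ℕ) := by
    intro i hi
    obtain ⟨h1, h2, -⟩ := hrefl i hi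
    simp only [κ]
    rw [Nat.mod_eq_of_lt (by omega), Int.toNat_of_nonneg h1]
  let μ : Fin n ⊕ Fin 3 → Fin n ⊕ Fin 3 := fun v => match v with
    | Sum.inl i => if h : ∃ g, g ∈ a ∧ r g = i then Sum.inr h.choose else Sum.inl (κ i)
    | Sum.inr g => Sum.inl (r g)
  have hμ1 : ∀ g ∈ a, μ (Sum.inl (r g)) = Sum.inr g := by
    intro g hg
    have h : ∃ g', g' ∈ a ∧ r g' = r g := ⟨g, hg, rfl⟩
    simp only [μ, dif_pos h]
    rw [hr _ h.choose_spec.1 g hg h.choose_spec.2]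
  have hμ2 : ∀ i, (∀ g ∈ a, r g ≠ i) → μ (Sum.inl i) = Sum.inl (κ i) := by
    intro i hi
    exact dif_neg (by rintro ⟨g, hg, h⟩; exact hi g hg h)
  have hκ' : ∀ i, (∀ g ∈ a, r g ≠ i) → ∀ g ∈ a, r g ≠ κ i := by
    intro i hi g hg h
    refine (hrefl i hi).2.2.2 g hg ?_
    rw [h, hκ i hi]
  have hκκ : ∀ i, (∀ g ∈ a, r g ≠ i) → κ (κ i) = i := by
    intro i hi
    have h1 := hκ i hi
    have h2 := hκ (κ i) (hκ' i hi)
    exact Fin.ext (by omega)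
  have hpot : ∀ g, g ∈ a → potential n δ (r g) < 4 * n ^ 2 + 4 := fun g _ =>
    potential_lt hδ (r g).2
  have hslack : ∀ g ∈ a, ∀ j, j ≠ r g → (if (g, j) ∈ H then 4 * n ^ 2 + 4 else 0) <
      4 * n ^ 2 + 4 - potential n δ (r g) + potential n δ j := by
    intro g hg j hj
    have h1 := hpot g hg
    split_ifs with h
    · have h2 := hH' g hg j h hj
      have h3 : potential n δ (r g) < potential n δ j := by
        zify
        rw [potential_eq hδ (r g).2, potential_eq hδ j.2]
        linarith
      omega
    · omega
  have hentry : ∀ i j : Fin n, entryWeight n (i + j) ≤ potential n δ i + potential n δ j := by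
    intro i j
    have h1 := potential_add_potential hδ i.2 j.2
    have h2 := sq_nonneg ((i : ℤ) + (j : ℕ) - (n - 1) - δ)
    zify
    push_cast at h1
    linarith
  have hω : ∀ g ∈ a, ∀ j, (if (g, j) ∈ H then 4 * n ^ 2 + 4 else 0) ≤
      4 * n ^ 2 + 4 - potential n δ (r g) + potential n δ j := by
    intro g hg j
    by_cases hj : j = r g
    · subst hj
      have h1 := hpot g hg
      split_ifs <;> omega
    · exact (hslack g hg j hj).le
  have hω' : ∀ g j, (if (g, j) ∈ H then 4 * n ^ 2 + 4 else 0) ≤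
      vertexPotential δ a r (Sum.inr g) + vertexPotential δ a r (Sum.inl j) := by
    intro g j
    simp only [vertexPotential]
    by_cases hg : g ∈ a
    · rw [if_pos hg]; exact hω g hg j
    · rw [if_neg hg]; split_ifs <;> omega
  refine hasLeadingMonomial_pfList _ _ _ (edgeWeight H) (vertexPotential δ a r)
    (extMatrix_eq_var K H) ?_ μ _ (vertexList_nodup ha) ?_ ?_ ?_
  · rintro (i | g) (j | g')
    · exact hentry i j
    · rw [add_comm]; exact hω' g' i
    · exact hω' g j
    · exact Nat.zero_le _
  · rintro (i | g) hi
    · by_cases h : ∃ g ∈ a, r g = i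
      · obtain ⟨g, hg, rfl⟩ := h
        rw [hμ1 g hg]
        exact ⟨inr_mem_vertexList.2 hg, by simp, rfl⟩
      · push Not at h
        rw [hμ2 i h, hμ2 _ (hκ' i h), hκκ i h]
        refine ⟨inl_mem_vertexList _ _, fun h' => (hrefl i h).2.2.1 ?_, rfl⟩
        rw [← hκ i h, Sum.inl_injective h']
    · have hg := inr_mem_vertexList.1 hi
      exact ⟨inl_mem_vertexList _ _, by simp [μ], hμ1 g hg⟩
  · have hrow : ∀ g ∈ a, edgeWeight H (Sum.inr g) (Sum.inl (r g)) =
        vertexPotential δ a r (Sum.inr g) + vertexPotential δ a r (Sum.inl (r g)) := by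
      intro g hg
      have h1 := hpot g hg
      simp only [edgeWeight, vertexPotential, if_pos hg, if_pos (hH g hg)]
      omega
    rintro (i | g) hi
    · by_cases h : ∃ g ∈ a, r g = i
      · obtain ⟨g, hg, rfl⟩ := h
        rw [hμ1 g hg, add_comm]
        exact ⟨hrow g hg, Sum.inr (g, r g), ⟨hg, rfl⟩, Or.inr (by simp [extMatrix, genU])⟩
      · push Not at h
        have h2 := hκ i h
        have hne : i ≠ κ i := fun h' => (hrefl i h).2.2.1 (by rw [← hκ i h, ← h'])
        rw [hμ2 i h]
        constructor
        · have h1 := potential_add_potential hδ i.2 (κ i).2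
          rw [show ((i : ℕ) : ℤ) + ((κ i : ℕ) : ℤ) - (n - 1) - δ = 0 by omega] at h1
          simp only [edgeWeight, vertexPotential]
          zify
          push_cast at h1
          linarith
        · obtain ⟨p, hp, hp'⟩ := genC_eq_var K hne
          refine ⟨Sum.inl p, ?_, by simpa [extMatrix] using hp'⟩
          change ((p.1.1 : ℕ) : ℤ) + (p.1.2 : ℕ) = n - 1 + δ
          omega
    · have hg := inr_mem_vertexList.1 hi
      exact ⟨hrow g hg, Sum.inr (g, r g), ⟨hg, rfl⟩, Or.inl (by simp [extMatrix, genU, μ])⟩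
  · rintro (i | g) hi (j | g') hj hij
    · by_cases hij' : ((i : ℕ) : ℤ) + (j : ℕ) - (n - 1) - δ = 0
      · by_cases h : ∃ g ∈ a, r g = i
        · obtain ⟨g, hg, rfl⟩ := h
          by_cases h' : ∃ g' ∈ a, r g' = j
          · obtain ⟨g', hg', rfl⟩ := h'
            by_cases hgg : g = g'
            · left; simp [extMatrix, genC, hgg]
            · exact absurd (by omega) (hpair g hg g' hg' hgg)
          · push Not at h'
            exact absurd (by omega) ((hrefl j h').2.2.2 g hg)
        · push Not at h
          exfalso
          rw [hμ2 i h] at hij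
          have := hκ i h
          exact hij (congrArg Sum.inl (Fin.ext (by omega)))
      · right
        have h1 := potential_add_potential hδ i.2 j.2
        have h2 : 0 < ((i : ℤ) + (j : ℕ) - (n - 1) - δ) ^ 2 := by positivity
        simp only [edgeWeight, vertexPotential]
        zify
        push_cast at h1
        linarith
    · right
      have hg := inr_mem_vertexList.1 hj
      simp only [edgeWeight, vertexPotential, if_pos hg]
      exact (hslack g' hg i fun h => hij (by rw [h, hμ1 g' hg])).trans_eq (add_comm _ _)
    · right
      have hg := inr_mem_vertexList.1 hi
      simp only [edgeWeight, vertexPotential, if_pos hg]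
      exact hslack g hg j fun h => hij (by rw [h])
    · left; simp [extMatrix]

theorem pfList_vertexList_nil (K : Type u) [Field K] (n : ℕ) :
    pfList (extMatrix (genC K n) (genU K n)) (vertexList n []) =
      pfaffian ((genC_isAlternating K n).extMatrix (genU K n)) (topVec _ n) := by
  have := pfaffian_prod_map ((genC_isAlternating K n).extMatrix (genU K n)) id (vertexList n [])
  rw [Matrix.submatrix_id_id] at this
  rw [← this]
  simp [vertexList, topVec, wedgeVec, Function.comp_def]

theorem pfList_vertexList_one (K : Type u) [Field K] (n : ℕ) (g : Fin 3) :
    pfList (extMatrix (genC K n) (genU K n)) (vertexList n [g]) =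
      pfaffian ((genC_isAlternating K n).extMatrix (genU K n)) (rowVec _ g * topVec _ n) := by
  have := pfaffian_prod_map ((genC_isAlternating K n).extMatrix (genU K n)) id (vertexList n [g])
  rw [Matrix.submatrix_id_id] at this
  rw [← this]
  simp [vertexList, topVec, wedgeVec, rowVec, Function.comp_def]

theorem pfList_vertexList_two (K : Type u) [Field K] (n : ℕ) (g h : Fin 3) :
    pfList (extMatrix (genC K n) (genU K n)) (vertexList n [g, h]) =
      pfaffian ((genC_isAlternating K n).extMatrix (genU K n))
        (rowVec _ g * (rowVec _ h * topVec _ n)) := by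
  have := pfaffian_prod_map ((genC_isAlternating K n).extMatrix (genU K n)) id
    (vertexList n [g, h])
  rw [Matrix.submatrix_id_id] at this
  rw [← this]
  simp [vertexList, topVec, wedgeVec, rowVec, Function.comp_def]

theorem disjoint_tightVars {δ δ' : ℤ} {a a' : List (Fin 3)} {r r' : Fin 3 → Fin n} (hδ : δ ≠ δ')
    (h : ∀ g ∈ a, g ∈ a' → r g ≠ r' g) : Disjoint (tightVars δ a r) (tightVars δ' a' r') := by
  rw [Set.disjoint_left]
  rintro (p | ⟨g, j⟩) h1 h2
  · change ((p.1.1 : ℕ) : ℤ) + (p.1.2 : ℕ) = n - 1 + δ at h1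
    change ((p.1.1 : ℕ) : ℤ) + (p.1.2 : ℕ) = n - 1 + δ' at h2
    omega
  · exact h g h1.1 h2.1 (h1.2.trans h2.2.symm)

/-- Row `0` is matched with column `0`, row `1` with the middle column, row `2` with the last one. -/
theorem koszulExact_odd (K : Type u) [Field K] (hn : 2 ≤ n) (hodd : Odd n)
    (x : Fin 3 → PolyRing K n)
    (hx : ∀ g, x g = pfaffian ((genC_isAlternating K n).extMatrix (genU K n))
      (rowVec _ g * topVec _ n)) :
    x 0 ≠ 0 ∧ KoszulExact ![x 0, x 1] ∧ KoszulExact ![x 0, x 1, x 2] := by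
  obtain ⟨m, hm⟩ := hodd
  let r : Fin 3 → Fin n := ![⟨0, by omega⟩, ⟨m, by omega⟩, ⟨n - 1, by omega⟩]
  let δ : Fin 3 → ℤ := ![1, 0, -1]
  refine HasLeadingMonomial.koszulExact (W := varWeight (Finset.univ.image fun g => (g, r g)))
    (P := fun g => tightVars (δ g) [g] r) (fun g => ?_) (fun g g' hg => ?_)
  · rw [hx, ← pfList_vertexList_one]
    refine hasLeadingMonomial_of_reflection K ?_ _ (List.nodup_singleton g) r ?_ ?_ ?_ ?_ ?_
    · fin_cases g <;> simp [δ]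
    · simp only [List.mem_singleton]; rintro _ rfl _ rfl _; rfl
    · simp
    · simp only [List.mem_singleton, Finset.mem_image, Finset.mem_univ, true_and, Prod.mk.injEq]
      rintro _ rfl j ⟨_, rfl, rfl⟩ h
      exact absurd rfl h
    · simp only [List.mem_singleton]; rintro _ rfl _ rfl h; exact absurd rfl h
    · simp only [List.mem_singleton, forall_eq, ne_eq]
      intro i
      have := i.2
      rw [Fin.ext_iff]
      fin_cases g <;> simp [δ, r] <;> omega
  · refine disjoint_tightVars ?_ ?_
    · fin_cases g <;> fin_cases g' <;> simp [δ] at hg ⊢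
    · simp only [List.mem_singleton]
      rintro _ rfl h
      exact absurd h hg

/-- With `n = 2m`, the generators are the Pfaffian of `C`, that on the rows `0, 1`, matched with
the columns `m - 1, n - 1`, and that on the rows `0, 2`, matched with the columns `m, 0`. The entries
`u_{0, m-1}` and `u_{0, m}` have the same weight, and the slopes of the potentials for `δ = -1` and
`δ = 1` decide between them. -/
theorem koszulExact_even (K : Type u) [Field K] (hn : 2 ≤ n) (heven : ¬ Odd n)
    (x : Fin 3 → PolyRing K n)
    (hx0 : x 0 = pfaffian ((genC_isAlternating K n).extMatrix (genU K n)) (topVec _ n))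
    (hx1 : x 1 = pfaffian ((genC_isAlternating K n).extMatrix (genU K n))
      (rowVec _ 0 * (rowVec _ 1 * topVec _ n)))
    (hx2 : x 2 = pfaffian ((genC_isAlternating K n).extMatrix (genU K n))
      (rowVec _ 0 * (rowVec _ 2 * topVec _ n))) :
    x 0 ≠ 0 ∧ KoszulExact ![x 0, x 1] ∧ KoszulExact ![x 0, x 1, x 2] := by
  obtain ⟨m, hm⟩ := Nat.not_odd_iff_even.1 heven
  let r₁ : Fin 3 → Fin n := ![⟨m - 1, by omega⟩, ⟨n - 1, by omega⟩, ⟨0, by omega⟩]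
  let r₂ : Fin 3 → Fin n := ![⟨m, by omega⟩, ⟨0, by omega⟩, ⟨0, by omega⟩]
  let H : Finset (Fin 3 × Fin n) := {(0, r₁ 0), (1, r₁ 1), (0, r₂ 0), (2, r₂ 2)}
  let δ : Fin 3 → ℤ := ![0, -1, 1]
  let a : Fin 3 → List (Fin 3) := ![[], [0, 1], [0, 2]]
  let r : Fin 3 → Fin 3 → Fin n := ![r₁, r₁, r₂]
  refine HasLeadingMonomial.koszulExact (W := varWeight H)
    (P := fun g => tightVars (δ g) (a g) (r g)) (fun g => ?_) (fun g g' hg => ?_)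
  · have hxg : x g = pfList (extMatrix (genC K n) (genU K n)) (vertexList n (a g)) := by
      fin_cases g
      · exact hx0.trans (pfList_vertexList_nil K n).symm
      · exact hx1.trans (pfList_vertexList_two K n 0 1).symm
      · exact hx2.trans (pfList_vertexList_two K n 0 2).symm
    rw [hxg]
    refine hasLeadingMonomial_of_reflection K ?_ H ?_ (r g) ?_ ?_ ?_ ?_ ?_
    · fin_cases g <;> simp [δ]
    · fin_cases g <;> simp [a]
    · fin_cases g <;> simp [a, r, r₁, r₂] <;> omega
    · fin_cases g <;> simp [a, r, H]
    · fin_cases g <;> simp [a, r, H, r₁, r₂, δ] <;> omega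
    · fin_cases g <;> simp [a, r, r₁, r₂, δ] <;> omega
    · intro i
      have := i.2
      fin_cases g <;> simp [a, r, r₁, r₂, δ] <;> (try simp only [Fin.ext_iff]) <;> omega
  · refine disjoint_tightVars ?_ ?_
    · fin_cases g <;> fin_cases g' <;> simp [δ] at hg ⊢
    · fin_cases g <;> fin_cases g' <;> simp [a, r, r₁, r₂] at hg ⊢ <;> omega

end Generic

/-! ### The presentation of the canonical module -/


section Main

theorem exists_isPresentation_of_nullHomotopic {R : Type u} [CommRing R] [IsDomain R]
    {m q n : Type} [Fintype m] [DecidableEq m] [Fintype q] [DecidableEq q] [Fintype n]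
    [DecidableEq n] {d₁ : m → R} {d₂ : Matrix m q R} {d₃ : Matrix q n R} {J : Ideal R}
    (hJ : Ideal.span (Set.range d₁) = J) (h32 : d₂ * d₃ = 0) (x : Fin 3 → R)
    (hx : ∀ i, NullHomotopic d₁ d₂ d₃ (x i))
    (hreg : x 0 ≠ 0 ∧ KoszulExact ![x 0, x 1] ∧ KoszulExact ![x 0, x 1, x 2]) :
    ∃ π : (n → R ⧸ J) →ₗ[R ⧸ J] ExtDual J 3,
      IsPresentation (d₃.transpose.map (Ideal.Quotient.mk J)) π := by
  obtain ⟨hx0, hk₂, hk₃⟩ := hreg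
  have hd₁ : ∀ a, Fintype.linearCombination R d₁ a = d₁ ⬝ᵥ a := fun a => by
    simp [Fintype.linearCombination_apply, dotProduct, mul_comm]
  refine exists_isPresentation_extDual J (Fintype.linearCombination R d₁) d₂.mulVecLin d₃
    ((Fintype.range_linearCombination R d₁).trans hJ) (fun a => ?_) (fun a => ?_)
    ((hx 0).mulVec_injective hx0)
  · rw [hd₁]
    constructor
    · exact exact_of_nullHomotopic_three (hx 0) (hx 1) (hx 2) h32 hk₂ hk₃ hx0
    · rintro ⟨b, rfl⟩
      rw [Matrix.mulVecLin_apply, Matrix.dotProduct_mulVec, (hx 0).vecMul_eq_zero hx0 h32,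
        zero_dotProduct]
  · constructor
    · exact exact_of_nullHomotopic_two (hx 0) (hx 1) hk₂ hx0
    · rintro ⟨b, rfl⟩
      rw [Matrix.mulVecLin_apply, Matrix.mulVecLin_apply, Matrix.mulVec_mulVec, h32,
        Matrix.zero_mulVec]

theorem transpose_map_mul_transpose_map_eq_zero {R : Type u} [CommRing R] {m q n : Type*}
    [Fintype n] {J : Ideal R} {D : Matrix q n R} {θ : Matrix m n R}
    (h : ∀ l r, ∑ j, D l j * θ r j ∈ J) :
    (D.transpose.map (Ideal.Quotient.mk J)).transpose *
      (θ.map (Ideal.Quotient.mk J)).transpose = 0 := by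
  ext l r
  simpa [Matrix.mul_apply] using Ideal.Quotient.eq_zero_iff_mem.2 (h l r)

variable (K : Type u) [Field K] (n : ℕ)

theorem exists_isPresentation_omega (hn : 2 ≤ n) :
    ∃ π : (Fin n → RingS K n) →ₗ[RingS K n] Omega K n, IsPresentation (d3tS K n) π := by
  have hC := genC_isAlternating K n
  by_cases hodd : Odd n
  · refine exists_isPresentation_of_nullHomotopic (d₁ := oddGens (genU K n) hC) ?_
      (contractMatrix_mul_fromRows (genU K n) hC basisVec_inl_mul_oddRows) _
      (nullHomotopic_odd (genU K n) hC) (koszulExact_odd K hn hodd _ fun g => rfl)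
    rw [span_range_oddGens, genJ, if_pos hodd]
  · obtain ⟨h0, h1, h2⟩ := nullHomotopic_even (genU K n) hC
    refine exists_isPresentation_of_nullHomotopic (d₁ := evenGens (genU K n) hC) ?_
      (contractMatrix_mul_fromRows (genU K n) hC basisVec_inl_mul_evenRows) ![_, _, _]
      (fun i => ?_) (koszulExact_even K hn hodd _ rfl rfl rfl)
    · rw [span_range_evenGens, genJ, if_neg hodd]
    · fin_cases i
      exacts [h0, h1, h2]

theorem transpose_d3tS_mul_matH : (d3tS K n).transpose * matH K n = 0 := by
  have hC := genC_isAlternating K n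
  refine transpose_map_mul_transpose_map_eq_zero fun l r => ?_
  by_cases hodd : Odd n
  · rw [genJ, if_pos hodd, if_pos hodd, ← span_range_oddGens (genU K n) hC]
    convert Ideal.mul_mem_left _ ((![1, 1, -1, 1] : Fin 4 → PolyRing K n) r)
      (sum_fromRows_mul_oddRows_mem (genU K n) hC r l) using 1
    rw [Finset.mul_sum]
    exact Finset.sum_congr rfl fun j _ => by
      rw [oddTheta_apply (genU K n) hC, genD3, mul_left_comm]
  · rw [genJ, if_neg hodd, if_neg hodd, ← span_range_evenGens (genU K n) hC]
    convert Ideal.mul_mem_left _ ((![1, -1, 1, -1] : Fin 4 → PolyRing K n) r)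
      (sum_fromRows_mul_evenRows_mem (genU K n) hC r l) using 1
    rw [Finset.mul_sum]
    exact Finset.sum_congr rfl fun j _ => by
      rw [evenTheta_apply (genU K n) hC, genD3, mul_left_comm]

end Main

end AlmostCI

theorem proposition1 (K : Type u) [Field K] (n : ℕ) (hn : 2 ≤ n) :
    (∃ π : (Fin n → AlmostCI.RingS K n) →ₗ[AlmostCI.RingS K n] AlmostCI.Omega K n,
      AlmostCI.IsPresentation (AlmostCI.d3tS K n) π) ∧
    ∀ π : (Fin n → AlmostCI.RingS K n) →ₗ[AlmostCI.RingS K n] AlmostCI.Omega K n,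
      AlmostCI.IsPresentation (AlmostCI.d3tS K n) π →
        LinearMap.range (AlmostCI.matH K n).mulVecLin ≤ AlmostCI.homIn π :=
  ⟨AlmostCI.exists_isPresentation_omega K n hn, fun _ hπ =>
    AlmostCI.range_mulVecLin_le_homIn hπ _ (AlmostCI.transpose_d3tS_mul_matH K n)⟩
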